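/- Let $\Gamma\subseteq\mathbb{R}^n$ be an open, symmetric, convex cone and let $f:\Gamma\to\mathbb{R}$ be a smooth, symmetric, convex function that is homogeneous of degree one and strictly increasing in each argument. Let $M$ be a smooth closed manifold of dimension $n$, let $T>0$, and let $X:M\times[0,T)\to\mathbb{R}^{n+1}$ be a smooth family of smooth immersions, with smooth unit normal field $\nu$, Weingarten map $\mathcal{W}=(dX)^{-1}\circ d\nu$ (the identity on the unit sphere with its outer normal) and principal curvatures $\kappa_1\le\dots\le\kappa_n$, the eigenvalues of $\mathcal{W}$ counted with multiplicity. Assume that $(\kappa_1,\dots,\kappa_n)(x,t)\in\Gamma$ for all $(x,t)\in M\times[0,T)$ and that $X$ solves the curvature flow $$\partial_t X(x,t)=-F(x,t)\,\nu(x,t),\qquad F(x,t)=f(\kappa_1(x,t),\dots,\kappa_n(x,t)),\qquad (x,t)\in M\times[0,T).$$ Suppose that for some $m\in\{1,\dots,n-1\}$ and some $\beta>0$ $$\kappa_{\sigma(1)}(x,0)+\dots+\kappa_{\sigma(m)}(x,0)\ \geq\ \beta\,F(x,0)$$ for all $x\in M$ and all permutations $\sigma$ of $\{1,\dots,n\}$.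 Then $$\kappa_{\sigma(1)}(x,t)+\dots+\kappa_{\sigma(m)}(x,t)\ \geq\ \beta\,F(x,t)$$ for all $x\in M$, all $t\in[0,T)$ and all permutations $\sigma$ of $\{1,\dots,n\}$. -/

import Mathlib

open scoped Manifold ContDiff

noncomputable section

namespace CurvatureFlow

/-- A speed function `f` on a cone `Γ ⊆ ℝⁿ`: `Γ` is an open, symmetric, convex cone, and `f` is
smooth, symmetric, homogeneous of degree one, strictly increasing in each argument, and convex
on `Γ`. The values of `f` outside `Γ` are irrelevant. -/
structure IsSpeedFunction {n : ℕ} (Γ : Set (Fin n → ℝ)) (f : (Fin n → ℝ) → ℝ) : Prop where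
  isOpen_cone : IsOpen Γ
  smul_mem : ∀ z ∈ Γ, ∀ c : ℝ, 0 < c → c • z ∈ Γ
  convex_cone : Convex ℝ Γ
  perm_mem : ∀ z ∈ Γ, ∀ σ : Equiv.Perm (Fin n), z ∘ σ ∈ Γ
  smooth : ContDiffOn ℝ ∞ f Γ
  symmetric : ∀ z ∈ Γ, ∀ σ : Equiv.Perm (Fin n), f (z ∘ σ) = f z
  homogeneous : ∀ z ∈ Γ, ∀ c : ℝ, 0 < c → f (c • z) = c * f z
  increasing : ∀ z ∈ Γ, ∀ i : Fin n, ∀ s : ℝ, 0 < s → z + Pi.single i s ∈ Γ →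
    f z < f (z + Pi.single i s)
  convex : ConvexOn ℝ Γ f

section Hypersurface

variable {n : ℕ} {M : Type*} [TopologicalSpace M] [ChartedSpace (EuclideanSpace ℝ (Fin n)) M]

/-- The differential at `x` of a map `Y : M → ℝⁿ⁺¹`, as a linear map on `T_x M`. The tangent space
`T_x M` of an `n`-manifold is by definition a copy of `ℝⁿ` (through the preferred chart at `x`). -/
def differential (Y : M → EuclideanSpace ℝ (Fin (n + 1))) (x : M) :
    EuclideanSpace ℝ (Fin n) →ₗ[ℝ] EuclideanSpace ℝ (Fin (n + 1)) :=
  (mfderiv (𝓡 n) 𝓘(ℝ, EuclideanSpace ℝ (Fin (n + 1))) Y x).toLinearMap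

/-- The Weingarten map `𝒲 = (dX)⁻¹ ∘ dν : T_x M → T_x M` of an immersion `X` with unit normal
field `ν`. Since `dν` takes values in the image of the injective map `dX`, this is the unique
linear map with `dX ∘ 𝒲 = dν`. With the outer normal, the unit sphere has `𝒲 = id`. -/
def weingartenMap (X ν : M → EuclideanSpace ℝ (Fin (n + 1))) (x : M) :
    Module.End ℝ (EuclideanSpace ℝ (Fin n)) :=
  (differential X x).leftInverse ∘ₗ differential ν x

/-- The principal curvatures `κ₁ ≤ ⋯ ≤ κₙ` at `x`: the eigenvalues of the Weingarten map, listed in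
increasing order and repeated according to multiplicity. (The Weingarten map is self-adjoint with
respect to the induced metric, so it has `n` real eigenvalues and the default `0` is not used.) -/
def principalCurvatures (X ν : M → EuclideanSpace ℝ (Fin (n + 1))) (x : M) : Fin n → ℝ :=
  fun i => ((weingartenMap X ν x).charpoly.roots.sort (· ≤ ·)).getD i 0

/-- `X : M × [0, T) → ℝⁿ⁺¹` is a solution of the curvature flow `∂ₜ X = - F(𝒲) ν` with speed
`F(𝒲) = f(κ₁, …, κₙ)`: a smooth family of smooth immersions with a smooth unit normal field `ν`,
whose principal curvatures lie in the domain `Γ` of `f`. The time derivative at `t = 0` is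
one-sided. -/
structure IsSolution (Γ : Set (Fin n → ℝ)) (f : (Fin n → ℝ) → ℝ) (T : ℝ)
    (X ν : ℝ → M → EuclideanSpace ℝ (Fin (n + 1))) : Prop where
  smooth : ContMDiffOn ((𝓡 n).prod 𝓘(ℝ, ℝ)) 𝓘(ℝ, EuclideanSpace ℝ (Fin (n + 1))) ∞
    (fun p : M × ℝ => X p.2 p.1) (Set.univ ×ˢ Set.Ico 0 T)
  smooth_normal : ContMDiffOn ((𝓡 n).prod 𝓘(ℝ, ℝ)) 𝓘(ℝ, EuclideanSpace ℝ (Fin (n + 1))) ∞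
    (fun p : M × ℝ => ν p.2 p.1) (Set.univ ×ˢ Set.Ico 0 T)
  immersion : ∀ t ∈ Set.Ico 0 T, ∀ x, Function.Injective (differential (X t) x)
  norm_normal : ∀ t ∈ Set.Ico 0 T, ∀ x, ‖ν t x‖ = 1
  inner_normal : ∀ t ∈ Set.Ico 0 T, ∀ x v, inner ℝ (differential (X t) x v) (ν t x) = 0
  curvatures_mem : ∀ t ∈ Set.Ico 0 T, ∀ x, principalCurvatures (X t) (ν t) x ∈ Γ
  flow : ∀ t ∈ Set.Ico 0 T, ∀ x, HasDerivWithinAt (fun s => X s x)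
    (-(f (principalCurvatures (X t) (ν t) x)) • ν t x) (Set.Ico 0 T) t

end Hypersurface

end CurvatureFlow

end

/-! The proof is a maximum principle argument. Let `Z = ∑_J κ - β f(κ)`, where `J` is the set of the
first `m` indices and `κ` runs over all orderings of the principal curvatures. If `Z` becomes
negative by time `t₁ < T`, then `exp (-K t) Z` has a negative minimum over the triples `(x, t, κ)`
with `t ≤ t₁`, which form a compact set (`isCompact_curvatureSet`). The minimum occurs at some `t₀ >
0`.

Ordered eigenvalues need not be smooth, so near the minimum the hypersurface is written as a graph
over its tangent plane, and `κ` is compared with the diagonal entries `Aᵢ` of the second fundamental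
form in a smooth orthonormal frame. By Schur these entries are a doubly stochastic image of `κ`
(`HasPrincipalCurvatures.exists_doublyStochastic`), hence by Birkhoff an average of permutations of
`κ` (`le_sum_mulVec_of_forall_perm`). This has two consequences. The smooth quantity `∑_J A - β F`
inherits the minimum. Since `f` is convex and symmetric, `F` lies above the affine function `f(κ₀) +
∑ dᵢ (Aᵢ - κ₀ᵢ)`, where `d` is the gradient of `f` at `κ₀`, with contact at the minimum point.

Second order expansions at that point give three facts: contact from below fixes the first
derivatives of `F` and bounds its second derivatives; spatial minimality makes the second
derivatives of `∑_J A - β F` nonnegative; and commuting fourth derivatives of the graph function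
gives a Simons identity. Combined in `reaction_algebra` with weights `dᵢ ≥ 0` and Euler's relation
`∑ dᵢ κᵢ = F`, they bound the time derivative of `∑_J A - β F` below by `(∑ dᵢ κᵢ²) Z`. Minimality
in time bounds it above by `K Z`. As `Z < 0`, this forces `∑ dᵢ κᵢ² ≥ K`, which fails once `K`
exceeds the maximum of that sum over the compact set. -/

open scoped Topology
open Filter

noncomputable section

namespace CurvatureFlow

/-! ### Linear algebra of principal frames -/

section PrincipalFrames

variable {ι E V : Type*} [NormedAddCommGroup V] [InnerProductSpace ℝ V]

/-- The numbers `κᵢ` are the principal curvatures, in some order, of an immersion with differential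
`D` and normal differential `N`: some vectors `vᵢ` are mapped by `D` to an orthonormal family and
satisfy `N vᵢ = κᵢ D vᵢ`. -/
def HasPrincipalCurvatures (D N : E → V) (κ : ι → ℝ) : Prop :=
  ∃ v : ι → E, Orthonormal ℝ (fun i => D (v i)) ∧ ∀ i, N (v i) = κ i • D (v i)

lemma HasPrincipalCurvatures.comp_perm {D N : E → V} {κ : ι → ℝ}
    (h : HasPrincipalCurvatures D N κ) (σ : Equiv.Perm ι) :
    HasPrincipalCurvatures D N (κ ∘ σ) := by
  obtain ⟨v, hv, hN⟩ := h
  exact ⟨v ∘ σ, hv.comp σ σ.injective, fun i => hN (σ i)⟩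

/-- This lemma and the next express invariance under change of parameters; they serve both for
manifold charts and for the passage to a graph. -/
lemma HasPrincipalCurvatures.of_comp {E' : Type*} {D N : E → V} {κ : ι → ℝ} {L : E' → E}
    (h : HasPrincipalCurvatures (fun v => D (L v)) (fun v => N (L v)) κ) :
    HasPrincipalCurvatures D N κ := by
  obtain ⟨v, hv, hN⟩ := h
  exact ⟨fun i => L (v i), hv, hN⟩

lemma HasPrincipalCurvatures.comp_of_surjective {E' : Type*} {D N : E → V} {κ : ι → ℝ} {L : E' → E}
    (h : HasPrincipalCurvatures D N κ) (hL : Function.Surjective L) :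
    HasPrincipalCurvatures (fun v => D (L v)) (fun v => N (L v)) κ := by
  obtain ⟨v, hv, hN⟩ := h
  choose w hw using fun i => hL (v i)
  exact ⟨w, by simpa only [hw] using hv, fun i => by simpa only [hw] using hN i⟩

variable [AddCommGroup E] [Module ℝ E] [Fintype ι]

/-- A family that an injective map `D` sends to an orthonormal one is a basis if it has the right
cardinality. -/
def frameBasis [FiniteDimensional ℝ E] (D : E →ₗ[ℝ] V) (hn : Module.finrank ℝ E = Fintype.card ι)
    (v : ι → E) (hv : Orthonormal ℝ (fun i => D (v i))) : Module.Basis ι ℝ E :=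
  basisOfLinearIndependentOfCardEqFinrank' v (hv.linearIndependent.of_comp D) hn.symm

@[simp] lemma frameBasis_apply [FiniteDimensional ℝ E] (D : E →ₗ[ℝ] V)
    (hn : Module.finrank ℝ E = Fintype.card ι) (v : ι → E)
    (hv : Orthonormal ℝ (fun i => D (v i))) (i : ι) : frameBasis D hn v hv i = v i := by
  simp [frameBasis]

/-- The diagonal entries of the second fundamental form in an orthonormal frame are obtained from
the principal curvatures by a doubly stochastic matrix. -/
lemma HasPrincipalCurvatures.exists_doublyStochastic [DecidableEq ι] [FiniteDimensional ℝ E]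
    {D N : E →ₗ[ℝ] V} {κ : ι → ℝ} (h : HasPrincipalCurvatures D N κ)
    (hn : Module.finrank ℝ E = Fintype.card ι) {ξ : ι → E}
    (hξ : Orthonormal ℝ (fun i => D (ξ i))) :
    ∃ A ∈ doublyStochastic ℝ ι, ∀ i, inner ℝ (N (ξ i)) (D (ξ i)) = A.mulVec κ i := by
  obtain ⟨v, hv, hN⟩ := h
  set b := frameBasis D hn v hv with hb
  set C : Matrix ι ι ℝ := fun i j => b.repr (ξ i) j with hC
  have hξC : ∀ i, ξ i = ∑ j, C i j • v j := fun i => by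
    simpa [hb] using (b.sum_repr (ξ i)).symm
  have hD : ∀ i, D (ξ i) = ∑ j, C i j • D (v j) := fun i => by
    conv_lhs => rw [hξC i]
    simp
  have hNs : ∀ i, N (ξ i) = ∑ j, (C i j * κ j) • D (v j) := fun i => by
    conv_lhs => rw [hξC i]
    simp [hN, smul_smul]
  have hCC : C * C.transpose = 1 := by
    ext i k
    have h1 := orthonormal_iff_ite.1 hξ i k
    rw [hD, hD, hv.inner_sum] at h1
    rw [Matrix.mul_apply, Matrix.one_apply, ← h1]
    rfl
  have hCC' : C.transpose * C = 1 := mul_eq_one_comm.1 hCC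
  -- The change of frame `C` is orthogonal, so its rows and columns are unit vectors and the squared
  -- entries form a doubly stochastic matrix.
  refine ⟨Matrix.of fun i j => C i j ^ 2, ?_, fun i => ?_⟩
  · rw [mem_doublyStochastic_iff_sum]
    refine ⟨fun i j => sq_nonneg _, fun i => ?_, fun j => ?_⟩
    · have := congrFun (congrFun hCC i) i
      rw [Matrix.mul_apply, Matrix.one_apply_eq] at this
      simpa [sq] using this
    · have := congrFun (congrFun hCC' j) j
      rw [Matrix.mul_apply, Matrix.one_apply_eq] at this
      simpa [sq] using this
  · rw [hD, hNs, hv.inner_sum]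
    refine Finset.sum_congr rfl fun j _ => ?_
    simp only [conj_trivial, Matrix.of_apply]
    ring

/-- A linear lower bound valid for all rearrangements of a vector is valid for its images under
doubly stochastic matrices. -/
lemma le_sum_mulVec_of_forall_perm [DecidableEq ι] {A : Matrix ι ι ℝ}
    (hA : A ∈ doublyStochastic ℝ ι) (l κ : ι → ℝ) {r : ℝ}
    (h : ∀ σ : Equiv.Perm ι, r ≤ ∑ i, l i * κ (σ i)) : r ≤ ∑ i, l i * A.mulVec κ i := by
  obtain ⟨w, hw0, hw1, hwA⟩ := exists_eq_sum_perm_of_mem_doublyStochastic hA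
  have e : ∑ i, l i * A.mulVec κ i = ∑ σ : Equiv.Perm ι, w σ * ∑ i, l i * κ (σ i) := by
    rw [← hwA]
    simp_rw [Matrix.sum_mulVec, Finset.sum_apply, Matrix.smul_mulVec, Pi.smul_apply,
      Matrix.permMatrix_mulVec, Finset.mul_sum, smul_eq_mul, Function.comp]
    rw [Finset.sum_comm]
    exact Finset.sum_congr rfl fun σ _ => Finset.sum_congr rfl fun i _ => by ring
  rw [e]
  calc r = ∑ σ : Equiv.Perm ι, w σ * r := by rw [← Finset.sum_mul, hw1, one_mul]
    _ ≤ _ := Finset.sum_le_sum fun σ _ => mul_le_mul_of_nonneg_left (h σ) (hw0 σ)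

/-- The spectral theorem for the Weingarten map. -/
lemma exists_hasPrincipalCurvatures [FiniteDimensional ℝ E] {n : ℕ} (hn : Module.finrank ℝ E = n)
    {D N : E →ₗ[ℝ] V} (hD : Function.Injective D) (hN : ∀ v, N v ∈ LinearMap.range D)
    (hsymm : ∀ v w, inner ℝ (N v) (D w) = inner ℝ (D v) (N w)) :
    ∃ κ : Fin n → ℝ, HasPrincipalCurvatures D N κ := by
  set e := LinearEquiv.ofInjective D hD with he
  -- The parameter space does not carry the induced metric, so the Weingarten map is transported to
  -- the range of `D`, where the ambient inner product makes it symmetric.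
  set T : LinearMap.range D →ₗ[ℝ] LinearMap.range D :=
    (N.codRestrict (LinearMap.range D) hN) ∘ₗ e.symm.toLinearMap with hT
  have heD : ∀ v, (e v : V) = D v := fun v => rfl
  have hDe : ∀ x, D (e.symm x) = (x : V) := fun x => by rw [← heD, e.apply_symm_apply]
  have hTN : ∀ x, (T x : V) = N (e.symm x) := fun x => rfl
  have hTs : T.IsSymmetric := by
    intro x y
    rw [Submodule.coe_inner, Submodule.coe_inner, hTN, hTN, ← hDe x, ← hDe y]
    simpa using hsymm (e.symm x) (e.symm y)
  have hr : Module.finrank ℝ (LinearMap.range D) = n := by rw [← hn, e.finrank_eq]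
  refine ⟨hTs.eigenvalues hr, fun i => e.symm (hTs.eigenvectorBasis hr i), ?_, fun i => ?_⟩
  · simp_rw [hDe]
    exact (hTs.eigenvectorBasis hr).orthonormal.comp_linearIsometry
      (LinearMap.range D).subtypeₗᵢ
  · rw [hDe, ← hTN, hTs.apply_eigenvectorBasis]
    rfl

/-- The sorted list of eigenvalues of the Weingarten map. -/
lemma HasPrincipalCurvatures.sort_roots_charpoly [FiniteDimensional ℝ E] {n : ℕ}
    (hn : Module.finrank ℝ E = n) {D N : E →ₗ[ℝ] V} (hD : Function.Injective D)
    {κ : Fin n → ℝ} (h : HasPrincipalCurvatures D N κ) :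
    (D.leftInverse ∘ₗ N).charpoly.roots.sort (· ≤ ·) = List.ofFn (κ ∘ Tuple.sort κ) := by
  obtain ⟨v, hv, hN⟩ := h
  set b := frameBasis D (by simpa using hn) v hv with hb
  have hker : LinearMap.ker D = ⊥ := LinearMap.ker_eq_bot.2 hD
  have hW : ∀ i, (D.leftInverse ∘ₗ N) (b i) = κ i • b i := fun i => by
    simp [hb, hN, LinearMap.leftInverse_apply_of_inj hker]
  have hmat : LinearMap.toMatrix b b (D.leftInverse ∘ₗ N) = Matrix.diagonal κ := by
    ext i j
    rw [LinearMap.toMatrix_apply, hW]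
    simp [Matrix.diagonal_apply, Finsupp.single_apply]
    split_ifs with h1 h2 h2 <;> simp_all
  have hroots : (D.leftInverse ∘ₗ N).charpoly.roots = Multiset.map κ Finset.univ.val := by
    rw [← LinearMap.charpoly_toMatrix _ b, hmat, Matrix.charpoly_diagonal,
      Polynomial.roots_prod _ _ (Finset.prod_ne_zero_iff.2 fun i _ => Polynomial.X_sub_C_ne_zero _)]
    simp
  rw [hroots, Fin.univ_val_map]
  refine List.Perm.eq_of_pairwise (le := (· ≤ ·)) ?_ (Multiset.pairwise_sort _ _) ?_ ?_
  · intro a b _ _ h1 h2; exact le_antisymm h1 h2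
  · rw [List.pairwise_ofFn]
    intro i j hij
    exact Tuple.monotone_sort κ hij.le
  · rw [← Multiset.coe_eq_coe, Multiset.sort_eq]
    rw [Multiset.coe_eq_coe]
    exact (Equiv.Perm.ofFn_comp_perm (Tuple.sort κ) κ).symm

end PrincipalFrames

/-! ### First order properties of the speed function -/

section Speed

variable {n : ℕ} {Γ : Set (Fin n → ℝ)} {f : (Fin n → ℝ) → ℝ}

namespace IsSpeedFunction

lemma differentiableAt (hf : IsSpeedFunction Γ f) {z : Fin n → ℝ} (hz : z ∈ Γ) :
    DifferentiableAt ℝ f z :=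
  (hf.smooth.contDiffAt (hf.isOpen_cone.mem_nhds hz)).differentiableAt (by simp)

/-- Convexity bounds the difference quotients along the segment from `z` to `w` by `f w - f z`; the
bound passes to the limit. -/
lemma add_fderiv_sub_le (hf : IsSpeedFunction Γ f) {z w : Fin n → ℝ} (hz : z ∈ Γ) (hw : w ∈ Γ) :
    f z + fderiv ℝ f z (w - z) ≤ f w := by
  have hd : HasDerivAt (fun s : ℝ => f (z + s • (w - z))) (fderiv ℝ f z (w - z)) 0 := by
    have h : HasDerivAt (fun s : ℝ => z + s • (w - z)) (w - z) 0 := by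
      simpa using ((hasDerivAt_id (0 : ℝ)).smul_const (w - z)).const_add z
    exact HasFDerivAt.comp_hasDerivAt (0 : ℝ)
      (by simpa using (hf.differentiableAt hz).hasFDerivAt) h
  have hlim := (hasDerivAt_iff_tendsto_slope.1 hd).mono_left (nhdsGT_le_nhdsNE 0)
  have : fderiv ℝ f z (w - z) ≤ f w - f z := by
    refine le_of_tendsto hlim ?_
    filter_upwards [Ioo_mem_nhdsGT (zero_lt_one' ℝ)] with s hs
    have hc := hf.convex.2 hz hw (sub_nonneg.2 hs.2.le) hs.1.le (by ring)
    have e : (1 - s) • z + s • w = z + s • (w - z) := by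
      rw [sub_smul, smul_sub, one_smul]; abel
    rw [e] at hc
    rw [slope_def_field]
    simp only [zero_smul, add_zero, sub_zero, smul_eq_mul] at hc ⊢
    rw [div_le_iff₀ hs.1]
    linarith
  linarith

lemma fderiv_single_nonneg (hf : IsSpeedFunction Γ f) {z : Fin n → ℝ} (hz : z ∈ Γ) (i : Fin n) :
    0 ≤ fderiv ℝ f z (Pi.single i 1) := by
  have h : HasDerivAt (fun s : ℝ => z + s • (Pi.single i 1 : Fin n → ℝ)) (Pi.single i 1) 0 := by
    simpa using ((hasDerivAt_id (0 : ℝ)).smul_const (Pi.single i 1 : Fin n → ℝ)).const_add z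
  have hd : HasDerivAt (fun s : ℝ => f (z + s • (Pi.single i 1 : Fin n → ℝ)))
      (fderiv ℝ f z (Pi.single i 1)) 0 :=
    HasFDerivAt.comp_hasDerivAt (0 : ℝ)
      (by simpa using (hf.differentiableAt hz).hasFDerivAt) h
  have hlim := (hasDerivAt_iff_tendsto_slope.1 hd).mono_left (nhdsGT_le_nhdsNE 0)
  have hmem : ∀ᶠ s : ℝ in 𝓝 0, z + s • (Pi.single i 1 : Fin n → ℝ) ∈ Γ :=
    h.continuousAt.eventually_mem (by simpa using hf.isOpen_cone.mem_nhds hz)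
  refine ge_of_tendsto hlim ?_
  filter_upwards [hmem.filter_mono nhdsWithin_le_nhds, eventually_mem_nhdsWithin] with s hs hs0
  have hs0 : 0 < s := hs0
  have e : s • (Pi.single i 1 : Fin n → ℝ) = Pi.single i s := by
    rw [← Pi.single_smul, smul_eq_mul, mul_one]
  rw [slope_def_field]
  rw [e] at hs ⊢
  simp only [zero_smul, add_zero, sub_zero]
  exact div_nonneg (sub_nonneg.2 (hf.increasing z hz i s hs0 hs).le) hs0.le

/-- Euler's relation: differentiate `f (s • z) = s * f z` at `s = 1`. -/
lemma fderiv_self (hf : IsSpeedFunction Γ f) {z : Fin n → ℝ} (hz : z ∈ Γ) :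
    fderiv ℝ f z z = f z := by
  have h : HasDerivAt (fun s : ℝ => s • z) z 1 := by
    simpa using (hasDerivAt_id (1 : ℝ)).smul_const z
  have hd : HasDerivAt (fun s : ℝ => f (s • z)) (fderiv ℝ f z z) 1 :=
    HasFDerivAt.comp_hasDerivAt (1 : ℝ)
      (by simpa using (hf.differentiableAt hz).hasFDerivAt) h
  have hd' : HasDerivAt (fun s : ℝ => f (s • z)) (f z) 1 := by
    have : HasDerivAt (fun s : ℝ => s * f z) (f z) 1 := by
      simpa using (hasDerivAt_id (1 : ℝ)).mul_const (f z)
    refine this.congr_of_eventuallyEq ?_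
    filter_upwards [lt_mem_nhds (zero_lt_one' ℝ)] with s hs
    exact hf.homogeneous z hz s hs
  exact hd.unique hd'

end IsSpeedFunction

lemma fderiv_apply_eq_sum (f : (Fin n → ℝ) → ℝ) (z x : Fin n → ℝ) :
    fderiv ℝ f z x = ∑ i, fderiv ℝ f z (Pi.single i 1) * x i := by
  conv_lhs => rw [pi_eq_sum_univ' x]
  simp [map_sum, mul_comm]

end Speed

/-! ### Second order expansions along lines -/

section Jets

/-- `g s = a + b s + c s² + o(s²)` as `s → 0`, `s ≠ 0`. -/
def HasTwoJet (g : ℝ → ℝ) (a b c : ℝ) : Prop :=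
  Tendsto (fun s => (g s - a - b * s) / s ^ 2) (𝓝[≠] 0) (𝓝 c)

lemma tendsto_id_punctured : Tendsto (fun s : ℝ => s) (𝓝[≠] 0) (𝓝 0) :=
  tendsto_nhdsWithin_of_tendsto_nhds tendsto_id

lemma eventually_ne_zero_punctured : ∀ᶠ s : ℝ in 𝓝[≠] 0, s ≠ 0 := eventually_mem_nhdsWithin

namespace HasTwoJet

variable {g g₁ g₂ : ℝ → ℝ} {a b c a₁ b₁ c₁ a₂ b₂ c₂ : ℝ}

lemma congr' (h : HasTwoJet g₁ a b c) (hg : g₁ =ᶠ[𝓝[≠] 0] g₂) : HasTwoJet g₂ a b c :=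
  Tendsto.congr' (hg.mono fun s hs => by simp only [hs]) h

lemma add (h₁ : HasTwoJet g₁ a₁ b₁ c₁) (h₂ : HasTwoJet g₂ a₂ b₂ c₂) :
    HasTwoJet (fun s => g₁ s + g₂ s) (a₁ + a₂) (b₁ + b₂) (c₁ + c₂) :=
  (Tendsto.add h₁ h₂).congr fun s => by ring

lemma const_mul (r : ℝ) (h : HasTwoJet g a b c) :
    HasTwoJet (fun s => r * g s) (r * a) (r * b) (r * c) :=
  (Tendsto.const_mul r h).congr fun s => by ring

lemma sub (h₁ : HasTwoJet g₁ a₁ b₁ c₁) (h₂ : HasTwoJet g₂ a₂ b₂ c₂) :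
    HasTwoJet (fun s => g₁ s - g₂ s) (a₁ - a₂) (b₁ - b₂) (c₁ - c₂) :=
  (Tendsto.sub h₁ h₂).congr fun s => by ring

lemma const (r : ℝ) : HasTwoJet (fun _ => r) r 0 0 := by
  simp [HasTwoJet]

lemma sum {ι : Type*} (t : Finset ι) {g : ι → ℝ → ℝ} {a b c : ι → ℝ}
    (h : ∀ i ∈ t, HasTwoJet (g i) (a i) (b i) (c i)) :
    HasTwoJet (fun s => ∑ i ∈ t, g i s) (∑ i ∈ t, a i) (∑ i ∈ t, b i) (∑ i ∈ t, c i) := by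
  refine (tendsto_finsetSum t h).congr fun s => ?_
  rw [← Finset.sum_div, Finset.sum_sub_distrib, Finset.sum_sub_distrib, Finset.sum_mul]

lemma mul (h₁ : HasTwoJet g₁ a₁ b₁ c₁) (h₂ : HasTwoJet g₂ a₂ b₂ c₂) :
    HasTwoJet (fun s => g₁ s * g₂ s) (a₁ * a₂) (a₁ * b₂ + b₁ * a₂)
      (a₁ * c₂ + b₁ * b₂ + c₁ * a₂) := by
  have hs := tendsto_id_punctured
  have key := ((((h₂.const_mul a₁).add_const (b₁ * b₂)).add (Tendsto.mul_const a₂ h₁)).add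
    (hs.mul ((h₂.const_mul b₁).add (h₁.const_mul b₂)))).add ((hs.pow 2).mul (Tendsto.mul h₁ h₂))
  simp only [zero_mul, add_zero, ne_eq, OfNat.ofNat_ne_zero, not_false_eq_true, zero_pow] at key
  refine key.congr' ?_
  filter_upwards [eventually_ne_zero_punctured] with s hs
  field_simp
  ring

lemma sq_mul {h : ℝ → ℝ} (hh : Tendsto h (𝓝[≠] 0) (𝓝 c)) :
    HasTwoJet (fun s => s ^ 2 * h s) 0 0 c := by
  refine Tendsto.congr' ?_ hh
  filter_upwards [eventually_ne_zero_punctured] with s hs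
  field_simp
  ring

lemma tendsto_div (h : HasTwoJet g a b c) :
    Tendsto (fun s => (g s - a) / s) (𝓝[≠] 0) (𝓝 b) := by
  have key := (tendsto_id_punctured.mul h).const_add b
  rw [zero_mul, add_zero] at key
  refine key.congr' ?_
  filter_upwards [eventually_ne_zero_punctured] with s hs
  field_simp
  ring

lemma nonpos_of_eventually_nonneg_left (h : HasTwoJet g 0 b c)
    (hg : ∀ᶠ s in 𝓝 0, s ≤ 0 → 0 ≤ g s) : b ≤ 0 := by
  refine le_of_tendsto (h.tendsto_div.mono_left (nhdsLT_le_nhdsNE 0)) ?_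
  filter_upwards [hg.filter_mono nhdsWithin_le_nhds, eventually_mem_nhdsWithin] with s hs hs'
  have hs' : s < 0 := hs'
  exact div_nonpos_of_nonneg_of_nonpos (by simpa using hs hs'.le) hs'.le

lemma nonneg_of_eventually_nonneg_right (h : HasTwoJet g 0 b c)
    (hg : ∀ᶠ s in 𝓝 0, 0 ≤ g s) : 0 ≤ b := by
  refine ge_of_tendsto (h.tendsto_div.mono_left (nhdsGT_le_nhdsNE 0)) ?_
  filter_upwards [hg.filter_mono nhdsWithin_le_nhds, eventually_mem_nhdsWithin] with s hs hs'
  have hs' : 0 < s := hs'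
  exact div_nonneg (by simpa using hs) hs'.le

lemma eq_zero_of_eventually_nonneg (h : HasTwoJet g 0 b c)
    (hg : ∀ᶠ s in 𝓝 0, 0 ≤ g s) : b = 0 :=
  le_antisymm (h.nonpos_of_eventually_nonneg_left (hg.mono fun _ hs _ => hs))
    (h.nonneg_of_eventually_nonneg_right hg)

lemma nonneg_of_eventually_nonneg (h : HasTwoJet g 0 b c)
    (hg : ∀ᶠ s in 𝓝 0, 0 ≤ g s) : 0 ≤ c := by
  have hb := h.eq_zero_of_eventually_nonneg hg
  subst hb
  refine ge_of_tendsto h ?_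
  filter_upwards [hg.filter_mono nhdsWithin_le_nhds] with s hs
  simpa using div_nonneg hs (sq_nonneg s)

end HasTwoJet

variable {E : Type*} [NormedAddCommGroup E] [NormedSpace ℝ E]

/-- The derivative of `u` in the direction `v`. -/
def dirDeriv (v : E) (u : E → ℝ) : E → ℝ := fun p => fderiv ℝ u p v

lemma contDiffAt_dirDeriv {u : E → ℝ} {p : E} (hu : ContDiffAt ℝ ∞ u p) (v : E) :
    ContDiffAt ℝ ∞ (dirDeriv v u) p :=
  (hu.fderiv_right (m := ∞) (by simp)).clm_apply contDiffAt_const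

lemma dirDeriv_congr {u₁ u₂ : E → ℝ} {p : E} (h : u₁ =ᶠ[𝓝 p] u₂) (v : E) :
    dirDeriv v u₁ =ᶠ[𝓝 p] dirDeriv v u₂ :=
  (h.fderiv (𝕜 := ℝ)).mono fun q hq => by simp only [dirDeriv, hq]

lemma dirDeriv_dirDeriv {u : E → ℝ} {p : E} (hu : ContDiffAt ℝ 2 u p) (v w : E) :
    dirDeriv v (dirDeriv w u) p = fderiv ℝ (fderiv ℝ u) p v w := by
  have h : DifferentiableAt ℝ (fderiv ℝ u) p :=
    (hu.fderiv_right (m := 1) (by norm_num)).differentiableAt (by simp)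
  unfold dirDeriv
  rw [fderiv_clm_apply h (differentiableAt_const _)]
  simp

lemma dirDeriv_comm {u : E → ℝ} {p : E} (hu : ContDiffAt ℝ ∞ u p) (v w : E) :
    dirDeriv v (dirDeriv w u) =ᶠ[𝓝 p] dirDeriv w (dirDeriv v u) := by
  have h2 : ContDiffAt ℝ 2 u p := contDiffAt_infty.1 hu 2
  filter_upwards [h2.eventually (by simp)] with q hq
  rw [dirDeriv_dirDeriv hq, dirDeriv_dirDeriv hq]
  exact hq.isSymmSndFDerivAt (by simp) v w

lemma hasDerivAt_line {u : E → ℝ} {p v : E} {s : ℝ} (hu : DifferentiableAt ℝ u (p + s • v)) :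
    HasDerivAt (fun r : ℝ => u (p + r • v)) (dirDeriv v u (p + s • v)) s := by
  have h : HasDerivAt (fun r : ℝ => p + r • v) v s := by
    simpa using ((hasDerivAt_id s).smul_const v).const_add p
  exact hu.hasFDerivAt.comp_hasDerivAt s h

lemma tendsto_line (p v : E) : Tendsto (fun s : ℝ => p + s • v) (𝓝 0) (𝓝 p) := by
  have : Continuous (fun s : ℝ => p + s • v) := by fun_prop
  simpa using this.tendsto 0

lemma tendsto_dirDeriv_line {u : E → ℝ} {p : E} (hu : DifferentiableAt ℝ u p) (v : E) :
    Tendsto (fun s : ℝ => (u (p + s • v) - u p) / s) (𝓝[≠] 0) (𝓝 (dirDeriv v u p)) := by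
  have h : HasDerivAt (fun r : ℝ => u (p + r • v)) (dirDeriv v u p) 0 := by
    simpa using hasDerivAt_line (u := u) (p := p) (v := v) (s := 0) (by simpa using hu)
  refine (hasDerivAt_iff_tendsto_slope.1 h).congr fun s => ?_
  simp [slope_def_field]

/-- One application of L'Hôpital's rule reduces the remainder to a difference quotient of the first
directional derivative. -/
lemma hasTwoJet_line {u : E → ℝ} {p : E} (hu : ContDiffAt ℝ ∞ u p) (v : E) :
    HasTwoJet (fun s : ℝ => u (p + s • v)) (u p) (dirDeriv v u p)
      (dirDeriv v (dirDeriv v u) p / 2) := by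
  have h1 := (hu.of_le (m := 1) (by exact_mod_cast le_top)).eventually (by simp)
  have h2 := (tendsto_line p v).eventually h1
  have hd := contDiffAt_dirDeriv hu v
  refine HasDerivAt.lhopital_zero_nhdsNE (f' := fun s => dirDeriv v u (p + s • v) - dirDeriv v u p)
    (g' := fun s => 2 * s) ?_ ?_ ?_ ?_ ?_ ?_
  · filter_upwards [h2.filter_mono nhdsWithin_le_nhds] with s hs
    have := ((hasDerivAt_line (hs.differentiableAt (by simp))).sub_const (u p)).sub
      ((hasDerivAt_id s).const_mul (dirDeriv v u p))
    simpa [Pi.sub_def] using this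
  · filter_upwards with s
    simpa using hasDerivAt_pow 2 s
  · filter_upwards [eventually_ne_zero_punctured] with s hs
    simpa using hs
  · have h3 := ((hu.continuousAt.tendsto.comp (tendsto_line p v)).mono_left
      (nhdsWithin_le_nhds (s := {0}ᶜ))).sub_const (u p)
    simpa using h3.sub (tendsto_id_punctured.const_mul (dirDeriv v u p))
  · simpa using tendsto_id_punctured.pow 2
  · refine ((tendsto_dirDeriv_line (hd.differentiableAt (by simp)) v).div_const 2).congr
      fun s => ?_
    rw [div_div, mul_comm]

end Jets

/-! ### Curvature of graphs at a critical point and the reaction inequality -/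

section GraphCalculus

lemma tendsto_bilin_apply {α E : Type*} [NormedAddCommGroup E] [NormedSpace ℝ E] {l : Filter α}
    {H : α → E →L[ℝ] E →L[ℝ] ℝ} {H₀ : E →L[ℝ] E →L[ℝ] ℝ} {v w : α → E} {v₀ w₀ : E}
    (hH : Tendsto H l (𝓝 H₀)) (hv : Tendsto v l (𝓝 v₀)) (hw : Tendsto w l (𝓝 w₀)) :
    Tendsto (fun s => H s (v s) (w s)) l (𝓝 (H₀ v₀ w₀)) := by
  have c : Continuous fun x : (E →L[ℝ] E →L[ℝ] ℝ) × E × E => x.1 x.2.1 x.2.2 := by fun_prop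
  exact (c.tendsto (H₀, v₀, w₀)).comp (hH.prodMk_nhds (hv.prodMk_nhds hw))

variable {ι : Type*} [Fintype ι] {E : Type*} [NormedAddCommGroup E] [NormedSpace ℝ E]

/-- The squared slope `|Du|²` of `u` with respect to the directions `ε`. -/
def slopeSq (ε : ι → E) (u : E → ℝ) (p : E) : ℝ := ∑ k, dirDeriv (ε k) u p ^ 2

/-- The factor `(1 + |Du|²)^(-1/2)`. -/
def normalFactor (ε : ι → E) (u : E → ℝ) (p : E) : ℝ := (√(1 + slopeSq ε u p))⁻¹

/-- The gradient `∑ₖ (∂ₖ u) εₖ`. -/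
def gradVec (ε : ι → E) (u : E → ℝ) (p : E) : E := ∑ k, dirDeriv (ε k) u p • ε k

/-- The coefficient `c` for which the vectors `εᵢ - c (∂ᵢ u) ∇u` lift to an orthonormal frame on the
graph of `u`. -/
def frameCoeff (ε : ι → E) (u : E → ℝ) (p : E) : ℝ :=
  normalFactor ε u p ^ 2 / (1 + normalFactor ε u p)

/-- The direction `εᵢ - c (∂ᵢ u) ∇u`, which lifts to a unit tangent vector of the graph of `u`. -/
def frameVec (ε : ι → E) (u : E → ℝ) (i : ι) (p : E) : E :=
  ε i - (frameCoeff ε u p * dirDeriv (ε i) u p) • gradVec ε u p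

/-- The `i`-th diagonal entry of the second fundamental form of the graph of `u` in the orthonormal
frame obtained by lifting `frameVec`. -/
def graphCurv (ε : ι → E) (u : E → ℝ) (i : ι) (p : E) : ℝ :=
  normalFactor ε u p * fderiv ℝ (fderiv ℝ u) p (frameVec ε u i p) (frameVec ε u i p)

lemma slopeSq_nonneg (ε : ι → E) (u : E → ℝ) (p : E) : 0 ≤ slopeSq ε u p :=
  Finset.sum_nonneg fun _ _ => sq_nonneg _

lemma normalFactor_pos (ε : ι → E) (u : E → ℝ) (p : E) : 0 < normalFactor ε u p :=
  inv_pos.2 (Real.sqrt_pos.2 (by linarith [slopeSq_nonneg ε u p]))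

lemma normalFactor_sq (ε : ι → E) (u : E → ℝ) (p : E) :
    normalFactor ε u p ^ 2 * (1 + slopeSq ε u p) = 1 := by
  have h := slopeSq_nonneg ε u p
  rw [normalFactor, inv_pow, Real.sq_sqrt (by linarith)]
  exact inv_mul_cancel₀ (by linarith)

/-- This is the orthonormality condition for the lifted frame. With `r = (1 + |Du|²)^(-1/2)`, the
choice `c = r² / (1 + r)` gives `I - c Du ⊗ Du = (I + Du ⊗ Du)^(-1/2)`, the inverse square root of
the induced metric. -/
lemma frameCoeff_identity (ε : ι → E) (u : E → ℝ) (p : E) :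
    -2 * frameCoeff ε u p + frameCoeff ε u p ^ 2 * slopeSq ε u p
      + (1 - frameCoeff ε u p * slopeSq ε u p) ^ 2 = 0 := by
  have h1 := normalFactor_pos ε u p
  have h2 := normalFactor_sq ε u p
  have h3 : slopeSq ε u p = (normalFactor ε u p ^ 2)⁻¹ - 1 := by
    field_simp
    linarith
  rw [h3, frameCoeff]
  field_simp
  ring

variable {ε : ι → E} {u : E → ℝ} {p : E}

omit [Fintype ι] in
lemma tendsto_slope_line (hu : ContDiffAt ℝ ∞ u p) (h0 : ∀ k, dirDeriv (ε k) u p = 0) (v : E)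
    (k : ι) : Tendsto (fun s : ℝ => dirDeriv (ε k) u (p + s • v) / s) (𝓝[≠] 0)
      (𝓝 (dirDeriv v (dirDeriv (ε k) u) p)) := by
  have := tendsto_dirDeriv_line ((contDiffAt_dirDeriv hu (ε k)).differentiableAt (by simp)) v
  simpa [h0] using this

lemma continuousAt_normalFactor (hu : ContDiffAt ℝ ∞ u p) :
    ContinuousAt (normalFactor ε u) p := by
  have h : ContinuousAt (slopeSq ε u) p := by
    refine tendsto_finsetSum _ fun k _ => ?_
    exact (contDiffAt_dirDeriv hu (ε k)).continuousAt.pow 2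
  refine ContinuousAt.inv₀ ((continuousAt_const.add h).sqrt) ?_
  exact (Real.sqrt_pos.2 (by linarith [slopeSq_nonneg ε u p])).ne'

lemma normalFactor_of_critical (h0 : ∀ k, dirDeriv (ε k) u p = 0) : normalFactor ε u p = 1 := by
  simp [normalFactor, slopeSq, h0]

lemma tendsto_normalFactor_line (hu : ContDiffAt ℝ ∞ u p) (h0 : ∀ k, dirDeriv (ε k) u p = 0)
    (v : E) : Tendsto (fun s : ℝ => normalFactor ε u (p + s • v)) (𝓝[≠] 0) (𝓝 1) := by
  rw [← normalFactor_of_critical h0]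
  exact ((continuousAt_normalFactor hu).tendsto.comp (tendsto_line p v)).mono_left
    nhdsWithin_le_nhds

/-- The gradient vanishes at `p`, so each `∂ₖ u` is linear in `s` to leading order, and `(1 +
|Du|²)^(-1/2) = 1 - |Du|² / 2 + o(s²)`. -/
lemma hasTwoJet_normalFactor (hu : ContDiffAt ℝ ∞ u p) (h0 : ∀ k, dirDeriv (ε k) u p = 0)
    (v : E) : HasTwoJet (fun s => normalFactor ε u (p + s • v)) 1 0
      (-(∑ k, dirDeriv v (dirDeriv (ε k) u) p ^ 2) / 2) := by
  have hr := tendsto_normalFactor_line hu h0 v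
  have hq : Tendsto (fun s : ℝ => ∑ k, (dirDeriv (ε k) u (p + s • v) / s) ^ 2) (𝓝[≠] 0)
      (𝓝 (∑ k, dirDeriv v (dirDeriv (ε k) u) p ^ 2)) :=
    tendsto_finsetSum _ fun k _ => (tendsto_slope_line hu h0 v k).pow 2
  have key := ((hq.neg).mul (hr.pow 2)).div (hr.const_add 1) (by norm_num)
  have e : -(∑ k, dirDeriv v (dirDeriv (ε k) u) p ^ 2) / 2
      = -(∑ k, dirDeriv v (dirDeriv (ε k) u) p ^ 2) * 1 ^ 2 / (1 + 1) := by ring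
  rw [e]
  refine key.congr' ?_
  filter_upwards [eventually_ne_zero_punctured] with s hs
  have h1 := normalFactor_pos ε u (p + s • v)
  have h2 := normalFactor_sq ε u (p + s • v)
  have h3 : ∑ k, (dirDeriv (ε k) u (p + s • v) / s) ^ 2 = slopeSq ε u (p + s • v) / s ^ 2 := by
    simp_rw [div_pow, ← Finset.sum_div, slopeSq]
  have h4 : slopeSq ε u (p + s • v) = (normalFactor ε u (p + s • v) ^ 2)⁻¹ - 1 := by
    field_simp
    linarith
  simp only [Pi.div_apply]
  rw [h3, h4]
  field_simp
  ring

lemma tendsto_frameCoeff_line (hu : ContDiffAt ℝ ∞ u p) (h0 : ∀ k, dirDeriv (ε k) u p = 0)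
    (v : E) : Tendsto (fun s : ℝ => frameCoeff ε u (p + s • v)) (𝓝[≠] 0) (𝓝 (1 / 2)) := by
  have hr := tendsto_normalFactor_line hu h0 v
  have := (hr.pow 2).div (hr.const_add 1) (by norm_num)
  norm_num at this
  simpa [frameCoeff, Pi.div_def] using this

lemma hasTwoJet_graphSpeed (hu : ContDiffAt ℝ ∞ u p) (h0 : ∀ k, dirDeriv (ε k) u p = 0)
    (τ v : E) :
    HasTwoJet (fun s => normalFactor ε u (p + s • v) * dirDeriv τ u (p + s • v))
      (dirDeriv τ u p) (dirDeriv v (dirDeriv τ u) p)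
      (dirDeriv v (dirDeriv v (dirDeriv τ u)) p / 2
        - (∑ k, dirDeriv v (dirDeriv (ε k) u) p ^ 2) / 2 * dirDeriv τ u p) := by
  have := (hasTwoJet_normalFactor hu h0 v).mul (hasTwoJet_line (contDiffAt_dirDeriv hu τ) v)
  convert this using 1 <;> ring

/-- `C a i` is the second order coefficient of `Aᵢ` in direction `a`, and `R` comes from the second
spatial derivatives of `∂ₜ u`. The inequalities `hconv` are summed over `a ∈ J`, and the
inequalities `hmin` over all `a` with weights `d a`. The two double sums of `C` differ by the
commutator `hC`, and Euler's relation cancels the terms in `F ∑_J κ²`. -/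
lemma reaction_algebra {κ d R : ι → ℝ} {C : ι → ι → ℝ} {F β : ℝ} (J : Finset ι)
    (hd : ∀ i, 0 ≤ d i) (hEuler : ∑ i, d i * κ i = F)
    (hC : ∀ a i, C a i - C i a = (κ i ^ 2 * κ a - κ a ^ 2 * κ i) / 2)
    (hconv : ∀ a, ∑ i, d i * C a i ≤ R a / 2 - κ a ^ 2 / 2 * F)
    (hmin : ∀ a, 0 ≤ ∑ i ∈ J, C a i - β * (R a / 2 - κ a ^ 2 / 2 * F)) :
    (∑ i, d i * κ i ^ 2) * (∑ i ∈ J, κ i - β * F) ≤ ∑ i ∈ J, R i - β * ∑ i, d i * R i := by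
  have hA : ∑ a ∈ J, (2 * ∑ i, d i * C a i + κ a ^ 2 * F) ≤ ∑ a ∈ J, R a :=
    Finset.sum_le_sum fun a _ => by linarith [hconv a]
  have hB : 0 ≤ ∑ a, d a * (∑ i ∈ J, C a i - β * (R a / 2 - κ a ^ 2 / 2 * F)) :=
    Finset.sum_nonneg fun a _ => mul_nonneg (hd a) (hmin a)
  have hswap : ∑ a ∈ J, ∑ i, d i * C a i = ∑ i, d i * ∑ a ∈ J, C i a
      + ((∑ i, d i * κ i ^ 2) * (∑ a ∈ J, κ a) - (∑ i, d i * κ i) * ∑ a ∈ J, κ a ^ 2) / 2 := by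
    rw [Finset.sum_comm, Finset.sum_mul_sum, Finset.sum_mul_sum, ← Finset.sum_sub_distrib,
      Finset.sum_div, ← Finset.sum_add_distrib]
    refine Finset.sum_congr rfl fun i _ => ?_
    rw [← Finset.sum_sub_distrib, Finset.sum_div, Finset.mul_sum, ← Finset.sum_add_distrib]
    refine Finset.sum_congr rfl fun a _ => ?_
    linear_combination d i * hC a i
  have hB' : ∑ a, d a * (∑ i ∈ J, C a i - β * (R a / 2 - κ a ^ 2 / 2 * F)) =
      ∑ i, d i * ∑ a ∈ J, C i a - β / 2 * ∑ i, d i * R i + β / 2 * F * ∑ i, d i * κ i ^ 2 := by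
    rw [Finset.mul_sum, Finset.mul_sum, ← Finset.sum_sub_distrib, ← Finset.sum_add_distrib]
    exact Finset.sum_congr rfl fun i _ => by ring
  rw [Finset.sum_add_distrib, ← Finset.mul_sum, ← Finset.sum_mul, hswap, hEuler] at hA
  rw [hB'] at hB
  linarith

variable [DecidableEq ι]

/-- The expansion of the diagonal entries of the second fundamental form of a graph at a critical
point, in coordinates diagonalising the Hessian. -/
lemma hasTwoJet_graphCurv (hu : ContDiffAt ℝ ∞ u p) (h0 : ∀ k, dirDeriv (ε k) u p = 0)
    {κ : ι → ℝ} (hκ : ∀ i j, dirDeriv (ε i) (dirDeriv (ε j) u) p = if i = j then κ i else 0)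
    (v : E) (i : ι) :
    HasTwoJet (fun s => graphCurv ε u i (p + s • v)) (κ i)
      (dirDeriv v (dirDeriv (ε i) (dirDeriv (ε i) u)) p)
      (dirDeriv v (dirDeriv v (dirDeriv (ε i) (dirDeriv (ε i) u))) p / 2
        - (∑ k, dirDeriv v (dirDeriv (ε k) u) p ^ 2) / 2 * κ i
        - dirDeriv v (dirDeriv (ε i) u) p ^ 2 * κ i) := by
  set q : ι → ℝ := fun k => dirDeriv v (dirDeriv (ε k) u) p with hq
  have h2 := contDiffAt_infty.1 hu 2
  set H := fderiv ℝ (fderiv ℝ u) with hH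
  have hHij : ∀ i j, H p (ε i) (ε j) = if i = j then κ i else 0 := fun i j => by
    rw [← hκ, dirDeriv_dirDeriv h2]
  have hHc : Tendsto (fun s : ℝ => H (p + s • v)) (𝓝[≠] 0) (𝓝 (H p)) := by
    have hc : ContinuousAt H p :=
      ((hu.fderiv_right (m := ∞) (by simp)).fderiv_right (m := ∞) (by simp)).continuousAt
    exact (hc.tendsto.comp (tendsto_line p v)).mono_left nhdsWithin_le_nhds
  have hr := tendsto_slope_line hu h0 v
  have hγ : Tendsto (fun s : ℝ => ∑ k, (dirDeriv (ε k) u (p + s • v) / s) • ε k) (𝓝[≠] 0)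
      (𝓝 (∑ k, q k • ε k)) :=
    tendsto_finsetSum _ fun k _ => (hr k).smul_const _
  set γ : ℝ → E := fun s => ∑ k, (dirDeriv (ε k) u (p + s • v) / s) • ε k with hγdef
  have hc := tendsto_frameCoeff_line hu h0 v
  have hεi : Tendsto (fun _ : ℝ => ε i) (𝓝[≠] 0) (𝓝 (ε i)) := tendsto_const_nhds
  have hcorr := ((hc.mul (hr i)).neg.mul ((tendsto_bilin_apply hHc hεi hγ).add
    (tendsto_bilin_apply hHc hγ hεi))).add ((tendsto_id_punctured.pow 2).mul
      (((hc.mul (hr i)).pow 2).mul (tendsto_bilin_apply hHc hγ hγ)))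
  -- The frame differs from `ε i` by a term of second order in `s`, with coefficient tending to `1 /
  -- 2`. The two mixed Hessian terms together contribute `-(q i)² κ i`, and the term quadratic in
  -- the correction disappears in the limit.
  have hlim : -(1 / 2 * q i) * (H p (ε i) (∑ k, q k • ε k) + H p (∑ k, q k • ε k) (ε i))
      + 0 ^ 2 * ((1 / 2 * q i) ^ 2 * H p (∑ k, q k • ε k) (∑ k, q k • ε k))
      = -(q i ^ 2 * κ i) := by
    simp only [map_sum, map_smul, hHij, sum_apply,
      smul_apply, smul_eq_mul, mul_ite, mul_zero, Finset.sum_ite_eq,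
      Finset.sum_ite_eq', Finset.mem_univ, if_true]
    ring
  rw [hlim] at hcorr
  have hmain := (hasTwoJet_normalFactor hu h0 v).mul
    ((hasTwoJet_line (contDiffAt_dirDeriv (contDiffAt_dirDeriv hu (ε i)) (ε i)) v).add
      (HasTwoJet.sq_mul hcorr))
  have h2e := (tendsto_line p v).eventually (h2.eventually (by simp))
  have key := hmain.congr' (g₂ := fun s => graphCurv ε u i (p + s • v)) ?_
  · rw [hκ i i] at key
    simp only [if_true] at key
    convert key using 1 <;> ring
  · filter_upwards [eventually_ne_zero_punctured, h2e.filter_mono nhdsWithin_le_nhds] with s hs hs2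
    have hg : gradVec ε u (p + s • v) = s • γ s := by
      simp only [gradVec, hγdef, Finset.smul_sum, smul_smul]
      refine Finset.sum_congr rfl fun k _ => ?_
      congr 1
      field_simp
    rw [dirDeriv_dirDeriv hs2, graphCurv, frameVec, hg]
    simp only [map_sub, map_smul, sub_apply, smul_apply,
      smul_eq_mul]
    field_simp
    ring

set_option maxHeartbeats 800000 in
/-- The pointwise maximum principle computation: at a space-time point where the graph of `u` is
horizontal, the speed `F` is supported from below by a linear function of the curvatures and the
quantity `∑_J κ - β F` attains a (weighted) minimum among earlier times, the reaction term of its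
evolution is controlled by the weight. -/
theorem reaction_le_of_spacetime_min (hu : ContDiffAt ℝ ∞ u p)
    (h0 : ∀ k, dirDeriv (ε k) u p = 0) {κ : ι → ℝ}
    (hκ : ∀ i j, dirDeriv (ε i) (dirDeriv (ε j) u) p = if i = j then κ i else 0)
    (τ : E) (J : Finset ι) (β K : ℝ) (d : ι → ℝ) (hd : ∀ i, 0 ≤ d i)
    (hEuler : ∑ i, d i * κ i = dirDeriv τ u p)
    (hsupp : ∀ᶠ q in 𝓝 p, dirDeriv τ u p + ∑ i, d i * (graphCurv ε u i q - κ i) ≤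
      normalFactor ε u q * dirDeriv τ u q)
    (hspace : ∀ a, ∀ᶠ s : ℝ in 𝓝 0, ∑ i ∈ J, κ i - β * dirDeriv τ u p ≤
      ∑ i ∈ J, graphCurv ε u i (p + s • ε a)
        - β * (normalFactor ε u (p + s • ε a) * dirDeriv τ u (p + s • ε a)))
    (htime : ∀ᶠ s : ℝ in 𝓝 0, s ≤ 0 →
      Real.exp (K * s) * (∑ i ∈ J, κ i - β * dirDeriv τ u p) ≤
      ∑ i ∈ J, graphCurv ε u i (p + s • τ)
        - β * (normalFactor ε u (p + s • τ) * dirDeriv τ u (p + s • τ))) :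
    (∑ i, d i * κ i ^ 2) * (∑ i ∈ J, κ i - β * dirDeriv τ u p) ≤
      K * (∑ i ∈ J, κ i - β * dirDeriv τ u p) := by
  set F := dirDeriv τ u p with hF
  set S : ι → ι → ℝ := fun a i =>
    dirDeriv (ε a) (dirDeriv (ε a) (dirDeriv (ε i) (dirDeriv (ε i) u))) p with hS
  set R : ι → ℝ := fun a => dirDeriv (ε a) (dirDeriv (ε a) (dirDeriv τ u)) p with hR
  have hSsymm : ∀ a i, S a i = S i a := by
    intro a i
    have e1 : dirDeriv (ε a) (dirDeriv (ε i) (dirDeriv (ε i) u)) =ᶠ[𝓝 p]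
        dirDeriv (ε i) (dirDeriv (ε i) (dirDeriv (ε a) u)) :=
      (dirDeriv_comm (contDiffAt_dirDeriv hu (ε i)) (ε a) (ε i)).trans
        (dirDeriv_congr (dirDeriv_comm hu (ε a) (ε i)) (ε i))
    have e2 := (dirDeriv_congr e1 (ε a)).trans
      ((dirDeriv_comm (contDiffAt_dirDeriv (contDiffAt_dirDeriv hu (ε a)) (ε i)) (ε a) (ε i)).trans
        (dirDeriv_congr (dirDeriv_comm (contDiffAt_dirDeriv hu (ε a)) (ε a) (ε i)) (ε i)))
    exact e2.eq_of_nhds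
  have hRsymm : ∀ i, dirDeriv τ (dirDeriv (ε i) (dirDeriv (ε i) u)) p = R i := by
    intro i
    exact ((dirDeriv_comm (contDiffAt_dirDeriv hu (ε i)) τ (ε i)).trans
      (dirDeriv_congr (dirDeriv_comm hu τ (ε i)) (ε i))).eq_of_nhds
  have hsq : ∀ a, ∑ k, dirDeriv (ε a) (dirDeriv (ε k) u) p ^ 2 = κ a ^ 2 := by
    intro a
    simp [hκ, ite_pow]
  have jA : ∀ a i, HasTwoJet (fun s => graphCurv ε u i (p + s • ε a)) (κ i)
      (dirDeriv (ε a) (dirDeriv (ε i) (dirDeriv (ε i) u)) p)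
      (S a i / 2 - κ a ^ 2 / 2 * κ i - if a = i then κ a ^ 3 else 0) := by
    intro a i
    have := hasTwoJet_graphCurv hu h0 hκ (ε a) i
    rw [hsq, hκ a i] at this
    convert this using 2
    split_ifs with h
    · subst h; ring
    · ring
  have jF : ∀ a, HasTwoJet (fun s => normalFactor ε u (p + s • ε a) * dirDeriv τ u (p + s • ε a))
      F (dirDeriv (ε a) (dirDeriv τ u) p) (R a / 2 - κ a ^ 2 / 2 * F) := by
    intro a
    have := hasTwoJet_graphSpeed hu h0 τ (ε a)
    rwa [hsq] at this
  have jAτ := hasTwoJet_graphCurv hu h0 hκ τ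
  have jFτ := hasTwoJet_graphSpeed hu h0 τ τ
  -- the support inequality
  have supp_jet : ∀ v, ∀ {cF : ℝ} {bF : ℝ} {bA cA : ι → ℝ},
      HasTwoJet (fun s => normalFactor ε u (p + s • v) * dirDeriv τ u (p + s • v)) F bF cF →
      (∀ i, HasTwoJet (fun s => graphCurv ε u i (p + s • v)) (κ i) (bA i) (cA i)) →
      bF = ∑ i, d i * bA i ∧ ∑ i, d i * cA i ≤ cF := by
    intro v cF bF bA cA h1 h2
    have j := h1.sub ((HasTwoJet.const F).add
      (HasTwoJet.sum Finset.univ fun i _ => ((h2 i).sub (HasTwoJet.const (κ i))).const_mul (d i)))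
    have hev : ∀ᶠ s : ℝ in 𝓝 0, 0 ≤ normalFactor ε u (p + s • v) * dirDeriv τ u (p + s • v)
        - (F + ∑ i, d i * (graphCurv ε u i (p + s • v) - κ i)) :=
      ((tendsto_line p v).eventually hsupp).mono fun s hs => sub_nonneg.2 hs
    simp only [sub_self, mul_zero, Finset.sum_const_zero, add_zero, zero_add, sub_zero] at j
    -- The gap vanishes at `s = 0` and is nonnegative on both sides, so its linear coefficient is
    -- zero and its quadratic one nonnegative. In the time direction the equality yields the
    -- evolution of `F`; in space the inequality replaces a second derivative of `f`.
    exact ⟨sub_eq_zero.1 (j.eq_zero_of_eventually_nonneg hev),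
      sub_nonneg.1 (j.nonneg_of_eventually_nonneg hev)⟩
  have hconv : ∀ a, ∑ i, d i * (S a i / 2 - κ a ^ 2 / 2 * κ i - if a = i then κ a ^ 3 else 0) ≤
      R a / 2 - κ a ^ 2 / 2 * F := fun a => (supp_jet (ε a) (jF a) (jA a)).2
  have hFt : dirDeriv τ (dirDeriv τ u) p = ∑ i, d i * R i := by
    rw [(supp_jet τ jFτ jAτ).1]
    simp_rw [hRsymm]
  -- the second derivative test in space
  have hmin : ∀ a, 0 ≤ ∑ i ∈ J, (S a i / 2 - κ a ^ 2 / 2 * κ i - if a = i then κ a ^ 3 else 0)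
      - β * (R a / 2 - κ a ^ 2 / 2 * F) := by
    intro a
    have j := ((HasTwoJet.sum J fun i _ => jA a i).sub ((jF a).const_mul β)).sub
      (HasTwoJet.const (∑ i ∈ J, κ i - β * F))
    rw [sub_self, sub_zero, sub_zero] at j
    exact j.nonneg_of_eventually_nonneg ((hspace a).mono fun s hs => sub_nonneg.2 hs)
  -- the first derivative test in time
  have hevol : ∑ i ∈ J, R i - β * ∑ i, d i * R i ≤ K * (∑ i ∈ J, κ i - β * F) := by
    have hexp := hasTwoJet_line (E := ℝ) (u := fun s => Real.exp (K * s)) (p := 0)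
      (by fun_prop) 1
    have hexp1 : dirDeriv (1 : ℝ) (fun s => Real.exp (K * s)) 0 = K := by
      have : HasDerivAt (fun s => Real.exp (K * s)) (Real.exp (K * 0) * (K * 1)) 0 :=
        ((hasDerivAt_id (0 : ℝ)).const_mul K).exp
      simp only [dirDeriv, fderiv_apply_one_eq_deriv]
      rw [this.deriv]
      simp
    rw [hexp1] at hexp
    simp only [zero_add, smul_eq_mul, mul_one, mul_zero, Real.exp_zero] at hexp
    have j := ((HasTwoJet.sum J fun i _ => jAτ i).sub (jFτ.const_mul β)).sub
      (hexp.const_mul (∑ i ∈ J, κ i - β * F))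
    rw [mul_one, sub_self, hFt, Finset.sum_congr rfl fun i _ => hRsymm i] at j
    -- Only earlier times are compared, so just one sign of the time derivative is obtained.
    have := j.nonpos_of_eventually_nonneg_left (htime.mono fun s hs h => by
      have := hs h
      linarith)
    linarith
  refine le_trans (reaction_algebra J hd hEuler (fun a i => ?_) hconv hmin) hevol
  -- The fourth derivatives cancel by symmetry, and the cubic curvature terms that remain are the
  -- Simons commutator.
  rw [hSsymm a i]
  by_cases h : a = i
  · subst h; ring
  · rw [if_neg h, if_neg (Ne.symm h)]; ring

end GraphCalculus

/-! ### Geometry of graphs over a hyperplane -/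

section GraphFlow

variable {n : ℕ}

/-- The spatial coordinate directions in `ℝⁿ × ℝ`. -/
def spaceDir (n : ℕ) (k : Fin n) : EuclideanSpace ℝ (Fin n) × ℝ := (EuclideanSpace.single k 1, 0)

variable (b : OrthonormalBasis (Option (Fin n)) ℝ (EuclideanSpace ℝ (Fin (n + 1))))
  (u : EuclideanSpace ℝ (Fin n) × ℝ → ℝ)

/-- The spatial differential of the graph map `(y, t) ↦ ∑ yₖ eₖ + u(y, t) N`, where
`e₁, …, eₙ, N` is an orthonormal basis. -/
def graphDifferential (p : EuclideanSpace ℝ (Fin n) × ℝ) :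
    EuclideanSpace ℝ (Fin n) →ₗ[ℝ] EuclideanSpace ℝ (Fin (n + 1)) where
  toFun v := ∑ k, v k • b (some k) + fderiv ℝ u p (v, 0) • b none
  map_add' v w := by
    have : ((v + w, 0) : EuclideanSpace ℝ (Fin n) × ℝ) = (v, 0) + (w, 0) := by simp
    rw [this, map_add]
    simp only [PiLp.add_apply, add_smul, Finset.sum_add_distrib]
    abel
  map_smul' c v := by
    have : ((c • v, 0) : EuclideanSpace ℝ (Fin n) × ℝ) = c • (v, 0) := by simp
    rw [this, map_smul]
    simp only [PiLp.smul_apply, smul_add, Finset.smul_sum, smul_smul, smul_eq_mul,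
      RingHom.id_apply]

variable {b u} {p : EuclideanSpace ℝ (Fin n) × ℝ}

lemma inner_graphDifferential (v : EuclideanSpace ℝ (Fin n)) (x : EuclideanSpace ℝ (Fin (n + 1))) :
    inner ℝ (graphDifferential b u p v) x =
      ∑ k, v k * inner ℝ (b (some k)) x + fderiv ℝ u p (v, 0) * inner ℝ (b none) x := by
  simp [graphDifferential, inner_add_left, sum_inner, real_inner_smul_left]

lemma inner_graphDifferential_self (v w : EuclideanSpace ℝ (Fin n)) :
    inner ℝ (graphDifferential b u p v) (graphDifferential b u p w) =
      ∑ k, v k * w k + fderiv ℝ u p (v, 0) * fderiv ℝ u p (w, 0) := by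
  have h1 : ∀ k, inner ℝ (b (some k)) (graphDifferential b u p w) = w k := fun k => by
    rw [real_inner_comm, inner_graphDifferential]
    simp [b.inner_eq_ite]
  have h2 : inner ℝ (b none) (graphDifferential b u p w) = fderiv ℝ u p (w, 0) := by
    rw [real_inner_comm, inner_graphDifferential]
    simp [b.inner_eq_ite]
  rw [inner_graphDifferential, h2]
  simp_rw [h1]

lemma frameVec_spaceDir_apply (i k : Fin n) :
    (frameVec (spaceDir n) u i p).1 k = (if k = i then 1 else 0) -
      frameCoeff (spaceDir n) u p * dirDeriv (spaceDir n i) u p * dirDeriv (spaceDir n k) u p := by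
  have h : (gradVec (spaceDir n) u p).1 k = dirDeriv (spaceDir n k) u p := by
    simp [gradVec, spaceDir, Prod.fst_sum, Finset.sum_apply, Pi.single_apply]
  simp only [frameVec, Prod.fst_sub, Prod.smul_fst, PiLp.sub_apply, PiLp.smul_apply, h,
    smul_eq_mul]
  simp [spaceDir]

lemma frameVec_spaceDir_eq (i : Fin n) :
    frameVec (spaceDir n) u i p = ((frameVec (spaceDir n) u i p).1, 0) := by
  ext1
  · rfl
  · simp [frameVec, gradVec, spaceDir, Prod.snd_sum]

lemma fderiv_frameVec (i : Fin n) :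
    fderiv ℝ u p (frameVec (spaceDir n) u i p) = dirDeriv (spaceDir n i) u p *
      (1 - frameCoeff (spaceDir n) u p * slopeSq (spaceDir n) u p) := by
  have h : fderiv ℝ u p (gradVec (spaceDir n) u p) = slopeSq (spaceDir n) u p := by
    simp only [gradVec, slopeSq, map_sum, map_smul, smul_eq_mul, sq]
    rfl
  rw [frameVec, map_sub, map_smul, h, smul_eq_mul]
  change dirDeriv (spaceDir n i) u p - _ = _
  ring

lemma orthonormal_graphFrame :
    Orthonormal ℝ (fun i => graphDifferential b u p (frameVec (spaceDir n) u i p).1) := by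
  rw [orthonormal_iff_ite]
  intro i j
  rw [inner_graphDifferential_self, ← frameVec_spaceDir_eq, ← frameVec_spaceDir_eq,
    fderiv_frameVec, fderiv_frameVec]
  have hc := frameCoeff_identity (spaceDir n) u p
  simp_rw [frameVec_spaceDir_apply]
  set c := frameCoeff (spaceDir n) u p
  set g : Fin n → ℝ := fun k => dirDeriv (spaceDir n k) u p with hg
  set q := slopeSq (spaceDir n) u p with hq
  have hsum : ∑ k, ((if k = i then (1 : ℝ) else 0) - c * g i * g k) *
      ((if k = j then 1 else 0) - c * g j * g k)
      = (if i = j then 1 else 0) - 2 * c * g i * g j + c ^ 2 * g i * g j * q := by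
    have e : ∀ k, ((if k = i then (1 : ℝ) else 0) - c * g i * g k) *
        ((if k = j then 1 else 0) - c * g j * g k) =
        (if k = i then (if k = j then 1 else 0) else 0) - c * g j * (if k = i then g k else 0)
        - c * g i * (if k = j then g k else 0) + c ^ 2 * g i * g j * g k ^ 2 := by
      intro k
      split_ifs <;> ring
    simp_rw [e, Finset.sum_add_distrib, Finset.sum_sub_distrib, ← Finset.mul_sum]
    simp only [Finset.sum_ite_eq', Finset.mem_univ, if_true, hq, slopeSq]
    ring
  rw [hsum]
  linear_combination g i * g j * hc

/-- The normal of a graph has vertical component `∓(1 + |Du|²)^(-1/2)`. -/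
lemma inner_normal_eq_neg_normalFactor {ν : EuclideanSpace ℝ (Fin (n + 1))} (hν : ‖ν‖ = 1)
    (hD : ∀ v, inner ℝ (graphDifferential b u p v) ν = 0) (hneg : inner ℝ (b none) ν < 0) :
    inner ℝ (b none) ν = -normalFactor (spaceDir n) u p := by
  have hk : ∀ k, inner ℝ (b (some k)) ν = -(dirDeriv (spaceDir n k) u p * inner ℝ (b none) ν) := by
    intro k
    have := hD (EuclideanSpace.single k 1)
    rw [inner_graphDifferential] at this
    simp only [PiLp.single_apply, ite_mul, one_mul, zero_mul, Finset.sum_ite_eq',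
      Finset.mem_univ, if_true] at this
    simp only [dirDeriv, spaceDir]
    linarith
  have hs := b.sum_sq_norm_inner_right ν
  rw [Fintype.sum_option, hν] at hs
  simp only [hk, Real.norm_eq_abs, sq_abs, neg_sq, mul_pow, ← Finset.sum_mul] at hs
  have h1 := normalFactor_sq (spaceDir n) u p
  have h2 := normalFactor_pos (spaceDir n) u p
  have h3 := slopeSq_nonneg (spaceDir n) u p
  have h4 : inner ℝ (b none) ν ^ 2 = normalFactor (spaceDir n) u p ^ 2 := by
    have h5 : inner ℝ (b none) ν ^ 2 * (1 + slopeSq (spaceDir n) u p) = 1 := by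
      rw [slopeSq]; linarith
    exact mul_right_cancel₀ (by linarith) (h5.trans h1.symm)
  rcases sq_eq_sq_iff_eq_or_eq_neg.1 h4 with h | h <;> linarith

/-- The second fundamental form of a graph. -/
lemma inner_fderiv_normal {ν : EuclideanSpace ℝ (Fin n) × ℝ → EuclideanSpace ℝ (Fin (n + 1))}
    (hu : ContDiffAt ℝ 2 u p) (hν : DifferentiableAt ℝ ν p)
    (hD : ∀ᶠ q in 𝓝 p, ∀ v, inner ℝ (graphDifferential b u q v) (ν q) = 0)
    (v w : EuclideanSpace ℝ (Fin n)) :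
    inner ℝ (fderiv ℝ ν p (v, 0)) (graphDifferential b u p w) =
      -(inner ℝ (b none) (ν p) * fderiv ℝ (fderiv ℝ u) p (v, 0) (w, 0)) := by
  have hdu : DifferentiableAt ℝ (fderiv ℝ u) p :=
    (hu.fderiv_right (m := 1) (by norm_num)).differentiableAt (by simp)
  have hin : ∀ x : EuclideanSpace ℝ (Fin (n + 1)), HasFDerivAt (fun q => inner ℝ x (ν q))
      ((innerSL ℝ x).comp (fderiv ℝ ν p)) p := fun x =>
    (innerSL ℝ x).hasFDerivAt.comp p hν.hasFDerivAt
  have hlin : HasFDerivAt (fun q => fderiv ℝ u q (w, 0))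
      ((fderiv ℝ (fderiv ℝ u) p).flip (w, 0)) p := by
    simpa using hdu.hasFDerivAt.clm_apply (hasFDerivAt_const (w, (0 : ℝ)) p)
  have h1 := (HasFDerivAt.fun_sum (u := Finset.univ)
    fun k _ => (hin (b (some k))).const_mul (w k)).add (hlin.mul (hin (b none)))
  have h2 : (fun q => ∑ k, w k * inner ℝ (b (some k)) (ν q) +
      fderiv ℝ u q (w, 0) * inner ℝ (b none) (ν q)) =ᶠ[𝓝 p] fun _ => 0 :=
    hD.mono fun q hq => by
      have h := hq w
      rwa [inner_graphDifferential] at h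
  have h3 := h1.unique ((hasFDerivAt_const (0 : ℝ) p).congr_of_eventuallyEq h2)
  have h4 := congrArg (fun L => L (v, (0 : ℝ))) h3
  simp only [add_apply, sum_apply, smul_apply, ContinuousLinearMap.comp_apply,
    innerSL_apply_apply, ContinuousLinearMap.flip_apply, smul_eq_mul, zero_apply] at h4
  rw [real_inner_comm, inner_graphDifferential]
  linarith

end GraphFlow

/-! ### The reaction inequality for a flow of graphs -/

section GraphFlow

variable {n : ℕ} {Γ : Set (Fin n → ℝ)} {f : (Fin n → ℝ) → ℝ}

/-- The maximum principle computation for a flow of graphs, at a point where the graph is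
horizontal. -/
theorem graph_reaction_le (hf : IsSpeedFunction Γ f)
    {b : OrthonormalBasis (Option (Fin n)) ℝ (EuclideanSpace ℝ (Fin (n + 1)))}
    {u : EuclideanSpace ℝ (Fin n) × ℝ → ℝ}
    {ν : EuclideanSpace ℝ (Fin n) × ℝ → EuclideanSpace ℝ (Fin (n + 1))}
    {p : EuclideanSpace ℝ (Fin n) × ℝ} (hu : ContDiffAt ℝ ∞ u p) (hν : ContDiffAt ℝ ∞ ν p)
    (hνp : ν p = -b none) (hnorm : ∀ᶠ q in 𝓝 p, ‖ν q‖ = 1)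
    (hD : ∀ᶠ q in 𝓝 p, ∀ v, inner ℝ (graphDifferential b u q v) (ν q) = 0)
    (hpc : ∀ᶠ q in 𝓝 p, ∃ κ : Fin n → ℝ, HasPrincipalCurvatures (graphDifferential b u q)
      (fun v => fderiv ℝ ν q (v, 0)) κ ∧ κ ∈ Γ ∧
      inner ℝ (b none) (ν q) * fderiv ℝ u q (0, 1) = -f κ)
    {κ₀ : Fin n → ℝ} (hκ₀ : κ₀ ∈ Γ)
    (hκ₀f : inner ℝ (b none) (ν p) * fderiv ℝ u p (0, 1) = -f κ₀)
    (hframe : ∀ i, fderiv ℝ ν p (spaceDir n i) = κ₀ i • b (some i))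
    (J : Finset (Fin n)) (β K : ℝ)
    (hmin : ∀ᶠ q in 𝓝 p, q.2 ≤ p.2 → ∀ κ : Fin n → ℝ,
      HasPrincipalCurvatures (graphDifferential b u q) (fun v => fderiv ℝ ν q (v, 0)) κ →
      Real.exp (K * (q.2 - p.2)) * (∑ i ∈ J, κ₀ i - β * f κ₀) ≤ ∑ i ∈ J, κ i - β * f κ) :
    (∑ i, fderiv ℝ f κ₀ (Pi.single i 1) * κ₀ i ^ 2) * (∑ i ∈ J, κ₀ i - β * f κ₀) ≤
      K * (∑ i ∈ J, κ₀ i - β * f κ₀) := by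
  have hneg : ∀ᶠ q in 𝓝 p, inner ℝ (b none) (ν q) < 0 := by
    have hc : ContinuousAt (fun q => inner ℝ (b none) (ν q)) p :=
      continuousAt_const.inner hν.continuousAt
    refine hc.eventually (gt_mem_nhds ?_)
    simp [hνp]
  have hνdiff : ∀ᶠ q in 𝓝 p, DifferentiableAt ℝ ν q :=
    ((contDiffAt_infty.1 hν 1).eventually (by simp)).mono fun q hq => hq.differentiableAt (by simp)
  have hu2 : ∀ᶠ q in 𝓝 p, ContDiffAt ℝ 2 u q := (contDiffAt_infty.1 hu 2).eventually (by simp)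
  have hnf : ∀ᶠ q in 𝓝 p, inner ℝ (b none) (ν q) = -normalFactor (spaceDir n) u q := by
    filter_upwards [hneg, hnorm, hD] with q h1 h2 h3
    exact inner_normal_eq_neg_normalFactor h2 h3 h1
  have hsff : ∀ᶠ q in 𝓝 p, ∀ v w, inner ℝ (fderiv ℝ ν q (v, 0)) (graphDifferential b u q w) =
      normalFactor (spaceDir n) u q * fderiv ℝ (fderiv ℝ u) q (v, 0) (w, 0) := by
    filter_upwards [hnf, hνdiff, hu2, hD.eventually_nhds] with q h1 h2 h3 h4 v w
    rw [inner_fderiv_normal h3 h2 h4, h1]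
    ring
  have h0 : ∀ k, dirDeriv (spaceDir n k) u p = 0 := by
    intro k
    have := hD.self_of_nhds (EuclideanSpace.single k 1)
    rw [inner_graphDifferential] at this
    simpa [hνp, b.inner_eq_ite, dirDeriv, spaceDir] using this
  have hone := normalFactor_of_critical h0
  have hb : ∀ i, graphDifferential b u p (EuclideanSpace.single i 1) = b (some i) := by
    intro i
    have h := h0 i
    simp only [dirDeriv, spaceDir] at h
    simp [graphDifferential, h]
  have hκ : ∀ i j, dirDeriv (spaceDir n i) (dirDeriv (spaceDir n j) u) p =
      if i = j then κ₀ i else 0 := by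
    intro i j
    have h := hsff.self_of_nhds (EuclideanSpace.single i 1) (EuclideanSpace.single j 1)
    have h' := hframe i
    rw [dirDeriv_dirDeriv hu2.self_of_nhds]
    simp only [spaceDir] at h' ⊢
    rw [h', hb, hone, one_mul, real_inner_smul_left, b.inner_eq_ite] at h
    rw [← h]
    simp
  have hF : ∀ q, dirDeriv (0, 1) u q = fderiv ℝ u q (0, 1) := fun q => rfl
  have hFp : dirDeriv (0, 1) u p = f κ₀ := by
    rw [hF]
    rw [hnf.self_of_nhds, hone] at hκ₀f
    linarith
  -- the diagonal second fundamental form at nearby points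
  have hschur : ∀ᶠ q in 𝓝 p, ∃ κ : Fin n → ℝ, ∃ A ∈ doublyStochastic ℝ (Fin n),
      HasPrincipalCurvatures (graphDifferential b u q) (fun v => fderiv ℝ ν q (v, 0)) κ ∧ κ ∈ Γ ∧
      normalFactor (spaceDir n) u q * dirDeriv (0, 1) u q = f κ ∧
      ∀ i, graphCurv (spaceDir n) u i q = A.mulVec κ i := by
    filter_upwards [hpc, hnf, hsff] with q hq hnfq hsffq
    obtain ⟨κ, h1, h2, h3⟩ := hq
    obtain ⟨A, hA, hAκ⟩ := HasPrincipalCurvatures.exists_doublyStochastic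
      (N := (fderiv ℝ ν q).toLinearMap ∘ₗ LinearMap.inl ℝ _ _) (D := graphDifferential b u q)
      (κ := κ) h1 (by simp) orthonormal_graphFrame
    refine ⟨κ, A, hA, h1, h2, ?_, fun i => ?_⟩
    · rw [hnfq] at h3
      rw [hF]
      linarith
    · rw [← hAκ, graphCurv]
      rw [frameVec_spaceDir_eq]
      exact (hsffq _ _).symm
  have hlow : ∀ᶠ q in 𝓝 p, q.2 ≤ p.2 →
      Real.exp (K * (q.2 - p.2)) * (∑ i ∈ J, κ₀ i - β * f κ₀) ≤
      ∑ i ∈ J, graphCurv (spaceDir n) u i q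
        - β * (normalFactor (spaceDir n) u q * dirDeriv (0, 1) u q) := by
    filter_upwards [hschur, hmin] with q hq hminq hle
    obtain ⟨κ, A, hA, h1, h2, h3, h4⟩ := hq
    -- With the indicator of `J` as linear form, the bound is needed for every permutation of `κ`.
    -- It holds because the minimum is taken over all orderings and `f` is symmetric.
    have key := le_sum_mulVec_of_forall_perm hA (fun i => if i ∈ J then 1 else 0) κ
      (r := Real.exp (K * (q.2 - p.2)) * (∑ i ∈ J, κ₀ i - β * f κ₀) + β * f κ) ?_
    · simp only [ite_mul, one_mul, zero_mul, Finset.sum_ite_mem, Finset.univ_inter] at key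
      rw [h3, Finset.sum_congr rfl fun i _ => h4 i]
      linarith
    · intro σ
      have := hminq hle _ (h1.comp_perm σ)
      rw [hf.symmetric κ h2 σ] at this
      simp only [ite_mul, one_mul, zero_mul, Finset.sum_ite_mem, Finset.univ_inter]
      simp only [Function.comp] at this
      linarith
  have main := reaction_le_of_spacetime_min (ε := spaceDir n) hu h0 hκ (0, 1) J β K
    (fun i => fderiv ℝ f κ₀ (Pi.single i 1)) (hf.fderiv_single_nonneg hκ₀) ?_ ?_ ?_ ?_
  · rwa [hFp] at main
  · rw [hFp, ← fderiv_apply_eq_sum, hf.fderiv_self hκ₀]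
  · filter_upwards [hschur] with q hq
    obtain ⟨κ, A, hA, h1, h2, h3, h4⟩ := hq
    -- The tangent plane inequality for `f` at `κ₀` holds at every permutation of `κ` with the same
    -- left side `f κ`, so it survives averaging.
    have key := le_sum_mulVec_of_forall_perm hA (fun i => -fderiv ℝ f κ₀ (Pi.single i 1)) κ
      (r := f κ₀ - f κ - ∑ i, fderiv ℝ f κ₀ (Pi.single i 1) * κ₀ i) ?_
    · rw [h3, hFp]
      simp only [h4, mul_sub, neg_mul, Finset.sum_neg_distrib, Finset.sum_sub_distrib] at key ⊢
      linarith
    · intro σ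
      have := hf.add_fderiv_sub_le hκ₀ (hf.perm_mem κ h2 σ)
      rw [hf.symmetric κ h2 σ, map_sub, fderiv_apply_eq_sum f κ₀ (κ ∘ σ),
        fderiv_apply_eq_sum f κ₀ κ₀] at this
      simp only [neg_mul, Finset.sum_neg_distrib]
      simp only [Function.comp] at this
      linarith
  · intro a
    filter_upwards [(tendsto_line p (spaceDir n a)).eventually hlow] with s hs
    have := hs (by simp [spaceDir])
    simpa [spaceDir, hFp] using this
  · filter_upwards [(tendsto_line p ((0 : EuclideanSpace ℝ (Fin n)), (1 : ℝ))).eventually hlow]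
      with s hs hs0
    have := hs (by simpa using hs0)
    rw [hFp]
    simpa using this

end GraphFlow

/-! ### From a chart to a graph over the tangent plane -/

section LocalFlow

variable {n : ℕ}

/-- The coordinates of a vector along the first `n` vectors of an orthonormal basis. -/
def planeProjection (b : OrthonormalBasis (Option (Fin n)) ℝ (EuclideanSpace ℝ (Fin (n + 1)))) :
    EuclideanSpace ℝ (Fin (n + 1)) →L[ℝ] EuclideanSpace ℝ (Fin n) :=
  ∑ k, (innerSL ℝ (b (some k))).smulRight (EuclideanSpace.single k 1)

@[simp] lemma planeProjection_apply
    (b : OrthonormalBasis (Option (Fin n)) ℝ (EuclideanSpace ℝ (Fin (n + 1))))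
    (x : EuclideanSpace ℝ (Fin (n + 1))) (k : Fin n) :
    planeProjection b x k = inner ℝ (b (some k)) x := by
  simp [planeProjection, sum_apply, Pi.single_apply]

/-- A unit normal completes an orthonormal frame of a hyperplane to an orthonormal basis. -/
lemma exists_orthonormalBasis_option {e : Fin n → EuclideanSpace ℝ (Fin (n + 1))}
    {N : EuclideanSpace ℝ (Fin (n + 1))} (he : Orthonormal ℝ e) (hN : ‖N‖ = 1)
    (heN : ∀ i, inner ℝ (e i) N = 0) :
    ∃ b : OrthonormalBasis (Option (Fin n)) ℝ (EuclideanSpace ℝ (Fin (n + 1))),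
      (∀ i, b (some i) = e i) ∧ b none = N := by
  set w : Option (Fin n) → EuclideanSpace ℝ (Fin (n + 1)) := fun o => o.elim N e with hw
  have ho : Orthonormal ℝ w := by
    rw [orthonormal_iff_ite]
    rintro (_ | i) (_ | j)
    · simp [hw, hN]
    · simpa [hw, real_inner_comm] using heN j
    · simpa [hw] using heN i
    · simpa [hw] using orthonormal_iff_ite.1 he i j
  have hcard : Fintype.card (Option (Fin n)) =
      Module.finrank ℝ (EuclideanSpace ℝ (Fin (n + 1))) := by simp
  refine ⟨(basisOfOrthonormalOfCardEqFinrank ho hcard).toOrthonormalBasis (by simpa using ho),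
    fun i => ?_, ?_⟩ <;> simp [hw]

variable {Γ : Set (Fin n → ℝ)} {f : (Fin n → ℝ) → ℝ}

/-- The maximum principle computation for a curvature flow in a chart: the hypersurface is written
as a graph over its tangent plane at the point under consideration. -/
theorem chart_reaction_le (hf : IsSpeedFunction Γ f)
    {Y ν : EuclideanSpace ℝ (Fin n) × ℝ → EuclideanSpace ℝ (Fin (n + 1))}
    {q₀ : EuclideanSpace ℝ (Fin n) × ℝ} (hY : ContDiffAt ℝ ∞ Y q₀) (hν : ContDiffAt ℝ ∞ ν q₀)
    (hinj : ∀ v, fderiv ℝ Y q₀ (v, 0) = 0 → v = 0)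
    (hflow : ∀ᶠ q in 𝓝 q₀, ‖ν q‖ = 1 ∧ (∀ v, inner ℝ (fderiv ℝ Y q (v, 0)) (ν q) = 0) ∧
      (∃ κ : Fin n → ℝ, HasPrincipalCurvatures (fun v => fderiv ℝ Y q (v, 0))
        (fun v => fderiv ℝ ν q (v, 0)) κ) ∧
      ∀ κ : Fin n → ℝ, HasPrincipalCurvatures (fun v => fderiv ℝ Y q (v, 0))
        (fun v => fderiv ℝ ν q (v, 0)) κ →
        κ ∈ Γ ∧ inner ℝ (fderiv ℝ Y q (0, 1)) (ν q) = -f κ)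
    {κ₀ : Fin n → ℝ} (hκ₀ : HasPrincipalCurvatures (fun v => fderiv ℝ Y q₀ (v, 0))
        (fun v => fderiv ℝ ν q₀ (v, 0)) κ₀)
    (J : Finset (Fin n)) (β K : ℝ)
    (hmin : ∀ᶠ q in 𝓝 q₀, q.2 ≤ q₀.2 → ∀ κ : Fin n → ℝ,
      HasPrincipalCurvatures (fun v => fderiv ℝ Y q (v, 0)) (fun v => fderiv ℝ ν q (v, 0)) κ →
      Real.exp (K * (q.2 - q₀.2)) * (∑ i ∈ J, κ₀ i - β * f κ₀) ≤ ∑ i ∈ J, κ i - β * f κ) :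
    (∑ i, fderiv ℝ f κ₀ (Pi.single i 1) * κ₀ i ^ 2) * (∑ i ∈ J, κ₀ i - β * f κ₀) ≤
      K * (∑ i ∈ J, κ₀ i - β * f κ₀) := by
  obtain ⟨hnorm₀, horth₀, -, hκ⟩ := hflow.self_of_nhds
  obtain ⟨hκ₀Γ, hκ₀f⟩ := hκ κ₀ hκ₀
  obtain ⟨v, hv, hNv⟩ := hκ₀
  beta_reduce at hv hNv
  obtain ⟨b, hb, hbN⟩ := exists_orthonormalBasis_option (N := -ν q₀) hv (by simpa using hnorm₀)
    (fun i => by simpa using horth₀ (v i))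
  have hext : ∀ x y : EuclideanSpace ℝ (Fin (n + 1)),
      (∀ k, inner ℝ (b (some k)) x = inner ℝ (b (some k)) y) →
      inner ℝ (b none) x = inner ℝ (b none) y → x = y := by
    intro x y h1 h2
    refine b.repr.injective ?_
    ext i
    rw [b.repr_apply_apply, b.repr_apply_apply]
    rcases i with _ | k
    · exact h2
    · exact h1 k
  -- Projection to the tangent plane at the base point, with time kept fixed. Its differential is
  -- injective there because the immersion has no component along the normal, so its local inverse
  -- `θ` reparametrises the flow as a graph.
  set ψ : EuclideanSpace ℝ (Fin n) × ℝ → EuclideanSpace ℝ (Fin n) × ℝ :=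
    fun q => (planeProjection b (Y q), q.2) with hψdef
  have hψ : ContDiffAt ℝ ∞ ψ q₀ :=
    ((planeProjection b).contDiff.contDiffAt.comp q₀ hY).prodMk contDiffAt_snd
  have hψd : ∀ q, DifferentiableAt ℝ Y q → HasFDerivAt ψ
      (((planeProjection b).comp (fderiv ℝ Y q)).prod (ContinuousLinearMap.snd ℝ _ _)) q :=
    fun q hq => ((planeProjection b).hasFDerivAt.comp q hq.hasFDerivAt).prodMk hasFDerivAt_snd
  set A := ((planeProjection b).comp (fderiv ℝ Y q₀)).prod
    (ContinuousLinearMap.snd ℝ (EuclideanSpace ℝ (Fin n)) ℝ) with hA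
  have hAinj : Function.Injective A := by
    rw [injective_iff_map_eq_zero]
    rintro ⟨w, s⟩ h
    have hs : s = 0 := congrArg Prod.snd h
    subst hs
    have h1 : planeProjection b (fderiv ℝ Y q₀ (w, 0)) = 0 := congrArg Prod.fst h
    have h2 : fderiv ℝ Y q₀ (w, 0) = 0 := by
      refine hext _ _ (fun k => ?_) ?_
      · rw [← planeProjection_apply, h1]
        simp
      · rw [hbN, inner_neg_left, real_inner_comm, horth₀]
        simp
    rw [hinj w h2]
    rfl
  set A' : (EuclideanSpace ℝ (Fin n) × ℝ) ≃L[ℝ] (EuclideanSpace ℝ (Fin n) × ℝ) :=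
    (LinearEquiv.ofInjectiveEndo A.toLinearMap hAinj).toContinuousLinearEquiv with hA'
  have hA'A : (A' : _ →L[ℝ] _) = A := by
    refine ContinuousLinearMap.ext fun x => ?_
    rfl
  have hYd : ∀ᶠ q in 𝓝 q₀, DifferentiableAt ℝ Y q :=
    ((contDiffAt_infty.1 hY 1).eventually (by simp)).mono fun q hq => hq.differentiableAt (by simp)
  have hνd : ∀ᶠ q in 𝓝 q₀, DifferentiableAt ℝ ν q :=
    ((contDiffAt_infty.1 hν 1).eventually (by simp)).mono fun q hq => hq.differentiableAt (by simp)
  have hψA : HasFDerivAt ψ (A' : _ →L[ℝ] _) q₀ := by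
    rw [hA'A]
    exact hψd q₀ hYd.self_of_nhds
  have hψs : HasStrictFDerivAt ψ (A' : _ →L[ℝ] _) q₀ := hψ.hasStrictFDerivAt' hψA (by simp)
  set p₀ := ψ q₀ with hp₀
  set θ := hψs.localInverse ψ A' q₀
  have hθ : ContDiffAt ℝ ∞ θ p₀ := hψ.to_localInverse hψA (by simp)
  have hθ₀ : θ p₀ = q₀ := hψs.localInverse_apply_image
  have hθt : Tendsto θ (𝓝 p₀) (𝓝 q₀) := by
    have := hθ.continuousAt.tendsto
    rwa [hθ₀] at this
  have hθd : ∀ᶠ p in 𝓝 p₀, DifferentiableAt ℝ θ p :=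
    ((contDiffAt_infty.1 hθ 1).eventually (by simp)).mono fun q hq => hq.differentiableAt (by simp)
  have hright : ∀ᶠ p in 𝓝 p₀, ψ (θ p) = p := hψs.eventually_right_inverse
  set u : EuclideanSpace ℝ (Fin n) × ℝ → ℝ := fun p => inner ℝ (b none) (Y (θ p)) with hu
  have hYθ : ContDiffAt ℝ ∞ (fun p => Y (θ p)) p₀ := ContDiffAt.comp p₀ (by rwa [hθ₀]) hθ
  have hνθ : ContDiffAt ℝ ∞ (fun p => ν (θ p)) p₀ := ContDiffAt.comp p₀ (by rwa [hθ₀]) hθ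
  have hus : ContDiffAt ℝ ∞ u p₀ := contDiffAt_const.inner ℝ hYθ
  -- the differentials of the reparametrised flow
  have hdiff : ∀ᶠ p in 𝓝 p₀,
      (∀ x, planeProjection b (fderiv ℝ Y (θ p) (fderiv ℝ θ p x)) = x.1) ∧
      (∀ x, (fderiv ℝ θ p x).2 = x.2) ∧
      (∀ x, inner ℝ (b none) (fderiv ℝ Y (θ p) (fderiv ℝ θ p x)) = fderiv ℝ u p x) ∧
      (∀ x, fderiv ℝ (fun p => ν (θ p)) p x = fderiv ℝ ν (θ p) (fderiv ℝ θ p x)) := by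
    filter_upwards [hright.eventually_nhds, hθd, hθt.eventually hYd, hθt.eventually hνd]
      with p h1 h2 h3 h4
    have e1 := ((hψd _ h3).comp p h2.hasFDerivAt).unique
      ((hasFDerivAt_id p).congr_of_eventuallyEq h1)
    have e2 : ∀ x, (planeProjection b (fderiv ℝ Y (θ p) (fderiv ℝ θ p x)), (fderiv ℝ θ p x).2) = x :=
      fun x => congrArg (fun L => L x) e1
    have e3 : HasFDerivAt u ((innerSL ℝ (b none)).comp ((fderiv ℝ Y (θ p)).comp (fderiv ℝ θ p))) p :=
      (innerSL ℝ (b none)).hasFDerivAt.comp p (h3.hasFDerivAt.comp p h2.hasFDerivAt)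
    refine ⟨fun x => (Prod.ext_iff.1 (e2 x)).1, fun x => (Prod.ext_iff.1 (e2 x)).2, fun x => ?_,
      fun x => ?_⟩
    · rw [e3.fderiv]
      rfl
    · have e4 : HasFDerivAt (fun p => ν (θ p)) ((fderiv ℝ ν (θ p)).comp (fderiv ℝ θ p)) p :=
        h4.hasFDerivAt.comp p h2.hasFDerivAt
      rw [e4.fderiv]
      rfl
  have hgraph : ∀ᶠ p in 𝓝 p₀, ∃ L : EuclideanSpace ℝ (Fin n) → EuclideanSpace ℝ (Fin n),
      Function.Surjective L ∧ (∀ w, graphDifferential b u p w = fderiv ℝ Y (θ p) (L w, 0)) ∧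
      (∀ w, fderiv ℝ (fun p => ν (θ p)) p (w, 0) = fderiv ℝ ν (θ p) (L w, 0)) := by
    filter_upwards [hdiff] with p hp
    obtain ⟨h1, h2, h3, h4⟩ := hp
    set L : EuclideanSpace ℝ (Fin n) →ₗ[ℝ] EuclideanSpace ℝ (Fin n) :=
      LinearMap.fst ℝ _ _ ∘ₗ (fderiv ℝ θ p).toLinearMap ∘ₗ LinearMap.inl ℝ _ _ with hL
    have hLw : ∀ w, fderiv ℝ θ p (w, 0) = (L w, 0) := fun w => Prod.ext rfl (h2 (w, 0))
    refine ⟨L, ?_, fun w => ?_, fun w => ?_⟩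
    · refine LinearMap.injective_iff_surjective.1 ((injective_iff_map_eq_zero L).2 fun w hw => ?_)
      have := h1 (w, 0)
      rw [hLw, hw, Prod.mk_zero_zero, map_zero, map_zero] at this
      exact this.symm
    · rw [← hLw]
      refine hext _ _ (fun k => ?_) ?_
      · rw [← planeProjection_apply, ← planeProjection_apply, h1, planeProjection_apply,
          real_inner_comm, inner_graphDifferential]
        simp [b.inner_eq_ite]
      · rw [h3, real_inner_comm, inner_graphDifferential]
        simp [b.inner_eq_ite]
    · rw [h4, hLw]
  have hiff : ∀ᶠ p in 𝓝 p₀, ∀ κ : Fin n → ℝ,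
      HasPrincipalCurvatures (graphDifferential b u p)
        (fun w => fderiv ℝ (fun p => ν (θ p)) p (w, 0)) κ ↔
      HasPrincipalCurvatures (fun w => fderiv ℝ Y (θ p) (w, 0))
        (fun w => fderiv ℝ ν (θ p) (w, 0)) κ := by
    filter_upwards [hgraph] with p hp κ
    obtain ⟨L, h1, h2, h3⟩ := hp
    have e : (graphDifferential b u p : EuclideanSpace ℝ (Fin n) → _) =
        fun w => fderiv ℝ Y (θ p) (L w, 0) := funext h2
    rw [e, funext h3]
    exact ⟨fun h => h.of_comp (L := L) (D := fun w => fderiv ℝ Y (θ p) (w, 0))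
      (N := fun w => fderiv ℝ ν (θ p) (w, 0)), fun h => h.comp_of_surjective h1⟩
  -- The reparametrisation changes the velocity only by a tangential vector, so the normal speed is
  -- preserved.
  have hspeed : ∀ᶠ p in 𝓝 p₀, inner ℝ (b none) (ν (θ p)) * fderiv ℝ u p (0, 1) =
      inner ℝ (fderiv ℝ Y (θ p) (0, 1)) (ν (θ p)) := by
    filter_upwards [hdiff, hθt.eventually hflow] with p hp hq
    obtain ⟨h1, h2, h3, -⟩ := hp
    have e1 : fderiv ℝ Y (θ p) (fderiv ℝ θ p (0, 1)) = fderiv ℝ u p (0, 1) • b none := by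
      refine hext _ _ (fun k => ?_) ?_
      · rw [← planeProjection_apply, h1, real_inner_smul_right]
        simp
      · rw [h3, real_inner_smul_right]
        simp
    have e2 : fderiv ℝ θ p (0, 1) = ((fderiv ℝ θ p (0, 1)).1, 0) + (0, 1) := by
      ext1
      · simp
      · simp [h2]
    have e3 := congrArg (fun x => inner ℝ x (ν (θ p))) e1
    simp only [real_inner_smul_left] at e3
    rw [e2, map_add, inner_add_left, hq.2.1, zero_add] at e3
    rw [e3, mul_comm]
  have hp₀2 : p₀.2 = q₀.2 := rfl
  have hθ2 : ∀ᶠ p in 𝓝 p₀, (θ p).2 = p.2 := hright.mono fun p hp => (Prod.ext_iff.1 hp).2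
  refine graph_reaction_le hf (b := b) (u := u) (ν := fun p => ν (θ p)) (p := p₀) hus hνθ ?_ ?_ ?_
    ?_ hκ₀Γ ?_ ?_ J β K ?_
  · rw [hbN, hθ₀, neg_neg]
  · exact (hθt.eventually hflow).mono fun p hp => hp.1
  · filter_upwards [hθt.eventually hflow, hgraph] with p hp hg w
    obtain ⟨L, h1, h2, h3⟩ := hg
    rw [h2]
    exact hp.2.1 _
  · filter_upwards [hθt.eventually hflow, hiff, hspeed] with p hp hi hs
    obtain ⟨κ, hκp⟩ := hp.2.2.1
    exact ⟨κ, (hi κ).2 hκp, (hp.2.2.2 κ hκp).1, hs.trans (hp.2.2.2 κ hκp).2⟩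
  · rw [hspeed.self_of_nhds, hθ₀, hκ₀f]
  · intro i
    obtain ⟨h1, h2, -, h4⟩ := hdiff.self_of_nhds
    have e : fderiv ℝ θ p₀ (spaceDir n i) = (v i, 0) := by
      refine hAinj (Prod.ext ?_ ?_)
      · have := h1 (spaceDir n i)
        rw [hθ₀] at this
        refine this.trans ?_
        change _ = planeProjection b (fderiv ℝ Y q₀ (v i, 0))
        ext k
        rw [planeProjection_apply, ← hb, b.inner_eq_ite]
        simp [spaceDir]
      · exact h2 _
    rw [h4, e, hθ₀, hNv, hb]
  · filter_upwards [hθt.eventually hmin, hiff, hθ2] with p hp hi h2 hle κ hκp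
    have := hp (by rw [h2]; exact hle) κ ((hi κ).1 hκp)
    rwa [h2] at this

end LocalFlow

/-! ### Limits of principal curvatures -/

section Limits

lemma tendsto_clm_apply {α E F : Type*} [NormedAddCommGroup E] [NormedSpace ℝ E]
    [NormedAddCommGroup F] [NormedSpace ℝ F] {l : Filter α} {D : α → E →L[ℝ] F} {D₀ : E →L[ℝ] F}
    {v : α → E} {v₀ : E} (hD : Tendsto D l (𝓝 D₀)) (hv : Tendsto v l (𝓝 v₀)) :
    Tendsto (fun a => D a (v a)) l (𝓝 (D₀ v₀)) := by
  have c : Continuous fun x : (E →L[ℝ] F) × E => x.1 x.2 := by fun_prop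
  exact (c.tendsto (D₀, v₀)).comp (hD.prodMk_nhds hv)

variable {ι α E V : Type*} [Fintype ι] [NormedAddCommGroup E] [NormedSpace ℝ E]
  [FiniteDimensional ℝ E] [NormedAddCommGroup V] [InnerProductSpace ℝ V]

/-- Principal curvatures converge along ultrafilters along which the differentials converge to those
of an immersion. -/
lemma HasPrincipalCurvatures.exists_tendsto {𝒰 : Ultrafilter α} {D N : α → E →L[ℝ] V}
    {D₀ N₀ : E →L[ℝ] V} {κ : α → ι → ℝ} (hD : Tendsto D 𝒰 (𝓝 D₀)) (hN : Tendsto N 𝒰 (𝓝 N₀))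
    (hinj : Function.Injective D₀)
    (h : ∀ᶠ a in (𝒰 : Filter α), HasPrincipalCurvatures (D a) (N a) (κ a)) :
    ∃ κ₀ : ι → ℝ, HasPrincipalCurvatures D₀ N₀ κ₀ ∧ Tendsto κ 𝒰 (𝓝 κ₀) := by
  classical
  obtain ⟨c, hc, hcD⟩ := D₀.toLinearMap.exists_antilipschitzWith (LinearMap.ker_eq_bot.2 hinj)
  have hbound : ∀ v, ‖v‖ ≤ c * ‖D₀ v‖ := fun v => by
    simpa using hcD.le_mul_dist v 0
  have hc' : (0 : ℝ) < c := by exact_mod_cast hc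
  choose! v hv using fun (a : α) (ha : HasPrincipalCurvatures (D a) (N a) (κ a)) => ha
  -- The radius `1 / (2 * c)` makes the error absorbable: `‖v‖ ≤ c + ‖v‖ / 2`, hence `‖v‖ ≤ 2 * c`.
  -- The frames then stay in a compact ball and converge along the ultrafilter.
  have hclose : ∀ᶠ a in (𝒰 : Filter α), ‖D₀ - D a‖ < 1 / (2 * c) := by
    have := (tendsto_const_nhds (x := D₀)).sub hD
    rw [sub_self] at this
    have h2 := this.norm
    rw [norm_zero] at h2
    exact h2.eventually (gt_mem_nhds (by positivity))
  have hvb : ∀ᶠ a in (𝒰 : Filter α), v a ∈ Metric.closedBall (0 : ι → E) (2 * c) := by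
    filter_upwards [hclose, h] with a ha hpc
    rw [mem_closedBall_zero_iff, pi_norm_le_iff_of_nonneg (by positivity)]
    intro i
    have h1 : ‖D a (v a i)‖ = 1 := (hv a hpc).1.1 i
    have h2 : ‖D₀ (v a i)‖ ≤ 1 + 1 / (2 * c) * ‖v a i‖ := by
      have e : D₀ (v a i) = D a (v a i) + (D₀ - D a) (v a i) := by simp
      rw [e]
      refine (norm_add_le _ _).trans (add_le_add h1.le ?_)
      exact ((D₀ - D a).le_opNorm _).trans (mul_le_mul_of_nonneg_right ha.le (norm_nonneg _))
    have h3 := (hbound (v a i)).trans (mul_le_mul_of_nonneg_left h2 hc'.le)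
    have h4 : (c : ℝ) * (1 + 1 / (2 * c) * ‖v a i‖) = c + ‖v a i‖ / 2 := by field_simp
    rw [h4] at h3
    linarith
  obtain ⟨v₀, -, hv₀⟩ := (isCompact_closedBall (0 : ι → E) (2 * c)).ultrafilter_le_nhds
    (𝒰.map v) (le_principal_iff.2 hvb)
  have hvt : ∀ i, Tendsto (fun a => v a i) 𝒰 (𝓝 (v₀ i)) := fun i =>
    ((continuous_apply i).tendsto v₀).comp (show Tendsto v 𝒰 (𝓝 v₀) from hv₀)
  have hDv : ∀ i, Tendsto (fun a => D a (v a i)) 𝒰 (𝓝 (D₀ (v₀ i))) := fun i => tendsto_clm_apply hD (hvt i)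
  have hNv : ∀ i, Tendsto (fun a => N a (v a i)) 𝒰 (𝓝 (N₀ (v₀ i))) := fun i => tendsto_clm_apply hN (hvt i)
  have hκt : ∀ i, Tendsto (fun a => κ a i) 𝒰 (𝓝 (inner ℝ (N₀ (v₀ i)) (D₀ (v₀ i)))) := by
    intro i
    refine ((hNv i).inner (hDv i)).congr' ?_
    filter_upwards [h] with a ha
    have h1 : ‖D a (v a i)‖ = 1 := (hv a ha).1.1 i
    rw [(hv a ha).2 i, real_inner_smul_left, real_inner_self_eq_norm_sq, h1]
    simp
  refine ⟨fun i => inner ℝ (N₀ (v₀ i)) (D₀ (v₀ i)), ⟨v₀, ?_, fun i => ?_⟩, tendsto_pi_nhds.2 hκt⟩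
  · rw [orthonormal_iff_ite]
    intro i j
    refine tendsto_nhds_unique ((hDv i).inner (hDv j)) (tendsto_const_nhds.congr' ?_)
    filter_upwards [h] with a ha
    exact (orthonormal_iff_ite.1 (hv a ha).1 i j).symm
  · refine tendsto_nhds_unique (hNv i) (((hκt i).smul (hDv i)).congr' ?_)
    filter_upwards [h] with a ha
    exact ((hv a ha).2 i).symm

end Limits

/-! ### The flow in manifold charts -/

section Charts

variable {n : ℕ} {M : Type*} [TopologicalSpace M] [ChartedSpace (EuclideanSpace ℝ (Fin n)) M]

/-- A time-dependent map on `M` in the preferred chart at `x₀`. -/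
def chartMap (x₀ : M) (Z : ℝ → M → EuclideanSpace ℝ (Fin (n + 1))) :
    EuclideanSpace ℝ (Fin n) × ℝ → EuclideanSpace ℝ (Fin (n + 1)) :=
  fun q => Z q.2 ((extChartAt (𝓡 n) x₀).symm q.1)

/-- The domain of `chartMap`. -/
def chartDomain (n : ℕ) {M : Type*} [TopologicalSpace M]
    [ChartedSpace (EuclideanSpace ℝ (Fin n)) M] (x₀ : M) (T : ℝ) : Set (EuclideanSpace ℝ (Fin n) × ℝ) :=
  (extChartAt (𝓡 n) x₀).target ×ˢ Set.Ico 0 T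

/-- The spatial differential of `chartMap`. -/
def chartDifferential (x₀ : M) (T : ℝ) (Z : ℝ → M → EuclideanSpace ℝ (Fin (n + 1)))
    (q : EuclideanSpace ℝ (Fin n) × ℝ) :
    EuclideanSpace ℝ (Fin n) →L[ℝ] EuclideanSpace ℝ (Fin (n + 1)) :=
  -- The derivative is taken within the domain so that continuity extends to the boundary time `t =
  -- 0`.
  (fderivWithin ℝ (chartMap x₀ Z) (chartDomain n x₀ T) q).comp (ContinuousLinearMap.inl ℝ _ _)

/-- The differential at `x` of the preferred chart at `x₀`. -/
def chartJacobian (x₀ x : M) : EuclideanSpace ℝ (Fin n) →L[ℝ] EuclideanSpace ℝ (Fin n) :=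
  mfderiv (𝓡 n) 𝓘(ℝ, EuclideanSpace ℝ (Fin n)) (extChartAt (𝓡 n) x₀) x

variable [IsManifold (𝓡 n) ∞ M] {x₀ : M} {T : ℝ} {Z : ℝ → M → EuclideanSpace ℝ (Fin (n + 1))}

lemma contDiffOn_chartMap
    (hZ : ContMDiffOn ((𝓡 n).prod 𝓘(ℝ, ℝ)) 𝓘(ℝ, EuclideanSpace ℝ (Fin (n + 1))) ∞
      (fun p : M × ℝ => Z p.2 p.1) (Set.univ ×ˢ Set.Ico 0 T)) :
    ContDiffOn ℝ ∞ (chartMap x₀ Z) (chartDomain n x₀ T) := by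
  rw [← contMDiffOn_iff_contDiffOn]
  have h1 : ContMDiffOn 𝓘(ℝ, EuclideanSpace ℝ (Fin n) × ℝ) ((𝓡 n).prod 𝓘(ℝ, ℝ)) ∞
      (fun q : EuclideanSpace ℝ (Fin n) × ℝ => ((extChartAt (𝓡 n) x₀).symm q.1, q.2))
      (chartDomain n x₀ T) := by
    refine ContMDiffOn.prodMk ?_ contDiff_snd.contMDiff.contMDiffOn
    exact (contMDiffOn_extChartAt_symm x₀).comp contDiff_fst.contMDiff.contMDiffOn
      fun q hq => hq.1
  exact hZ.comp h1 fun q hq => ⟨trivial, hq.2⟩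

lemma uniqueDiffOn_chartDomain (n : ℕ) {M : Type*} [TopologicalSpace M]
    [ChartedSpace (EuclideanSpace ℝ (Fin n)) M] (x₀ : M) (T : ℝ) : UniqueDiffOn ℝ (chartDomain n x₀ T) :=
  (isOpen_extChartAt_target x₀).uniqueDiffOn.prod (uniqueDiffOn_Ico 0 T)

lemma continuousOn_chartDifferential
    (hZ : ContMDiffOn ((𝓡 n).prod 𝓘(ℝ, ℝ)) 𝓘(ℝ, EuclideanSpace ℝ (Fin (n + 1))) ∞
      (fun p : M × ℝ => Z p.2 p.1) (Set.univ ×ˢ Set.Ico 0 T)) :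
    ContinuousOn (chartDifferential x₀ T Z) (chartDomain n x₀ T) :=
  ((contDiffOn_chartMap hZ).continuousOn_fderivWithin (uniqueDiffOn_chartDomain n x₀ T)
    (by simp)).clm_comp continuousOn_const

lemma hasFDerivAt_chartMap_slice
    (hZ : ContMDiffOn ((𝓡 n).prod 𝓘(ℝ, ℝ)) 𝓘(ℝ, EuclideanSpace ℝ (Fin (n + 1))) ∞
      (fun p : M × ℝ => Z p.2 p.1) (Set.univ ×ˢ Set.Ico 0 T))
    {z : EuclideanSpace ℝ (Fin n)} {t : ℝ} (hz : (z, t) ∈ chartDomain n x₀ T) :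
    HasFDerivAt (fun y => chartMap x₀ Z (y, t)) (chartDifferential x₀ T Z (z, t)) z := by
  have h1 := ((contDiffOn_chartMap (x₀ := x₀) hZ).differentiableOn (by simp) _
    hz).hasFDerivWithinAt
  have h2 : HasFDerivWithinAt (fun y : EuclideanSpace ℝ (Fin n) => (y, t))
      (ContinuousLinearMap.inl ℝ _ _) (extChartAt (𝓡 n) x₀).target z :=
    ((hasFDerivAt_id z).prodMk (hasFDerivAt_const t z)).hasFDerivWithinAt
  have h3 : Set.MapsTo (fun y : EuclideanSpace ℝ (Fin n) => (y, t)) (extChartAt (𝓡 n) x₀).target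
      (chartDomain n x₀ T) := fun y hy => ⟨hy, hz.2⟩
  exact (h1.comp z h2 h3).hasFDerivAt ((isOpen_extChartAt_target x₀).mem_nhds hz.1)

/-- The differential in terms of a chart. -/
lemma differential_eq_chartDifferential
    (hZ : ContMDiffOn ((𝓡 n).prod 𝓘(ℝ, ℝ)) 𝓘(ℝ, EuclideanSpace ℝ (Fin (n + 1))) ∞
      (fun p : M × ℝ => Z p.2 p.1) (Set.univ ×ˢ Set.Ico 0 T))
    {x : M} {t : ℝ} (hx : x ∈ (extChartAt (𝓡 n) x₀).source) (ht : t ∈ Set.Ico 0 T)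
    (v : EuclideanSpace ℝ (Fin n)) :
    differential (Z t) x v = chartDifferential x₀ T Z (extChartAt (𝓡 n) x₀ x, t)
      (chartJacobian x₀ x v) := by
  have hd : HasFDerivAt (fun y => chartMap x₀ Z (y, t)) _ (extChartAt (𝓡 n) x₀ x) :=
    hasFDerivAt_chartMap_slice hZ ⟨(extChartAt (𝓡 n) x₀).map_source hx, ht⟩
  have he : Z t =ᶠ[𝓝 x] (fun y => chartMap x₀ Z (y, t)) ∘ extChartAt (𝓡 n) x₀ := by
    filter_upwards [(isOpen_extChartAt_source x₀).mem_nhds hx] with y hy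
    simp only [chartMap, Function.comp, (extChartAt (𝓡 n) x₀).left_inv hy]
  have hφ : MDifferentiableAt (𝓡 n) 𝓘(ℝ, EuclideanSpace ℝ (Fin n)) (extChartAt (𝓡 n) x₀) x :=
    (contMDiffAt_extChartAt' (n := ∞) (by simpa using hx)).mdifferentiableAt (by simp)
  have hcomp := hd.hasMFDerivAt.comp x hφ.hasMFDerivAt
  unfold differential
  rw [he.mfderiv_eq, hcomp.mfderiv]
  rfl

lemma bijective_chartJacobian {x : M} (hx : x ∈ (extChartAt (𝓡 n) x₀).source) :
    Function.Bijective (chartJacobian (n := n) x₀ x) := by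
  have : IsManifold (𝓡 n) 1 M := IsManifold.of_le (n := ∞) (by simp)
  obtain ⟨e, he⟩ := isInvertible_mfderiv_extChartAt (I := 𝓡 n) (x := x₀) (y := x) hx
  rw [chartJacobian, ← he]
  exact e.bijective

end Charts

/-- The image of the differential of an immersed hypersurface is the orthogonal complement of the
normal. -/
lemma mem_range_of_inner_normal_eq_zero {n : ℕ}
    {D : EuclideanSpace ℝ (Fin n) →ₗ[ℝ] EuclideanSpace ℝ (Fin (n + 1))}
    (hD : Function.Injective D) {N : EuclideanSpace ℝ (Fin (n + 1))} (hN : N ≠ 0)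
    (hDN : ∀ v, inner ℝ (D v) N = 0) {y : EuclideanSpace ℝ (Fin (n + 1))}
    (hy : inner ℝ y N = 0) : y ∈ LinearMap.range D := by
  have hle : LinearMap.range D ≤ (Submodule.span ℝ {N})ᗮ := by
    rintro _ ⟨v, rfl⟩
    rw [Submodule.mem_orthogonal_singleton_iff_inner_left]
    exact hDN v
  have : Fact (Module.finrank ℝ (EuclideanSpace ℝ (Fin (n + 1))) = n + 1) := ⟨by simp⟩
  have hdim : Module.finrank ℝ (LinearMap.range D) =
      Module.finrank ℝ ((Submodule.span ℝ {N})ᗮ : Submodule ℝ _) := by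
    rw [LinearMap.finrank_range_of_inj hD, Submodule.finrank_orthogonal_span_singleton (n := n) hN]
    simp
  rw [Submodule.eq_of_le_of_finrank_eq hle hdim,
    Submodule.mem_orthogonal_singleton_iff_inner_left]
  exact hy

/-! ### Principal curvatures of a solution -/

namespace IsSolution

variable {n : ℕ} {M : Type*} [TopologicalSpace M] [ChartedSpace (EuclideanSpace ℝ (Fin n)) M]
  [IsManifold (𝓡 n) ∞ M] {Γ : Set (Fin n → ℝ)} {f : (Fin n → ℝ) → ℝ} {T : ℝ}
  {X ν : ℝ → M → EuclideanSpace ℝ (Fin (n + 1))}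

omit [IsManifold (𝓡 n) ∞ M] in
lemma norm_chartMap_normal (hX : IsSolution Γ f T X ν) {x₀ : M}
    {q : EuclideanSpace ℝ (Fin n) × ℝ} (hq : q ∈ chartDomain n x₀ T) : ‖chartMap x₀ ν q‖ = 1 :=
  hX.norm_normal _ hq.2 _

lemma inner_chartDifferential_normal (hX : IsSolution Γ f T X ν) {x₀ : M}
    {q : EuclideanSpace ℝ (Fin n) × ℝ} (hq : q ∈ chartDomain n x₀ T)
    (v : EuclideanSpace ℝ (Fin n)) :
    inner ℝ (chartDifferential x₀ T X q v) (chartMap x₀ ν q) = 0 := by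
  have hx := (extChartAt (𝓡 n) x₀).map_target hq.1
  obtain ⟨w, rfl⟩ := (bijective_chartJacobian hx).2 v
  have h := hX.inner_normal q.2 hq.2 ((extChartAt (𝓡 n) x₀).symm q.1) w
  rw [differential_eq_chartDifferential hX.smooth hx hq.2] at h
  rwa [(extChartAt (𝓡 n) x₀).right_inv hq.1] at h

lemma injective_chartDifferential (hX : IsSolution Γ f T X ν) {x₀ : M}
    {q : EuclideanSpace ℝ (Fin n) × ℝ} (hq : q ∈ chartDomain n x₀ T) :
    Function.Injective (chartDifferential x₀ T X q) := by
  have hx := (extChartAt (𝓡 n) x₀).map_target hq.1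
  have hb := bijective_chartJacobian hx
  have h := hX.immersion q.2 hq.2 ((extChartAt (𝓡 n) x₀).symm q.1)
  intro v w hvw
  obtain ⟨v, rfl⟩ := hb.2 v
  obtain ⟨w, rfl⟩ := hb.2 w
  refine congrArg _ (h ?_)
  rw [differential_eq_chartDifferential hX.smooth hx hq.2,
    differential_eq_chartDifferential hX.smooth hx hq.2, (extChartAt (𝓡 n) x₀).right_inv hq.1]
  exact hvw

lemma hasPrincipalCurvatures_chart_iff (hX : IsSolution Γ f T X ν) {x₀ x : M} {t : ℝ}
    (hx : x ∈ (extChartAt (𝓡 n) x₀).source) (ht : t ∈ Set.Ico 0 T) (κ : Fin n → ℝ) :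
    HasPrincipalCurvatures (chartDifferential x₀ T X (extChartAt (𝓡 n) x₀ x, t))
      (chartDifferential x₀ T ν (extChartAt (𝓡 n) x₀ x, t)) κ ↔
    HasPrincipalCurvatures (differential (X t) x) (differential (ν t) x) κ := by
  have e1 := funext (differential_eq_chartDifferential hX.smooth hx ht)
  have e2 := funext (differential_eq_chartDifferential hX.smooth_normal hx ht)
  rw [e1, e2]
  exact ⟨fun h => h.comp_of_surjective (bijective_chartJacobian hx).2, fun h => h.of_comp⟩

lemma contDiffAt_chartMap_slice {x₀ : M} {Z : ℝ → M → EuclideanSpace ℝ (Fin (n + 1))}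
    (hZ : ContMDiffOn ((𝓡 n).prod 𝓘(ℝ, ℝ)) 𝓘(ℝ, EuclideanSpace ℝ (Fin (n + 1))) ∞
      (fun p : M × ℝ => Z p.2 p.1) (Set.univ ×ˢ Set.Ico 0 T))
    {z : EuclideanSpace ℝ (Fin n)} {t : ℝ} (hz : (z, t) ∈ chartDomain n x₀ T) :
    ContDiffAt ℝ ∞ (fun y => chartMap x₀ Z (y, t)) z := by
  have h3 : Set.MapsTo (fun y : EuclideanSpace ℝ (Fin n) => (y, t)) (extChartAt (𝓡 n) x₀).target
      (chartDomain n x₀ T) := fun y hy => ⟨hy, hz.2⟩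
  exact ((contDiffOn_chartMap hZ).comp (contDiff_prodMk_left t).contDiffOn h3).contDiffAt
    ((isOpen_extChartAt_target x₀).mem_nhds hz.1)

/-- Differentiate `|ν|² = 1`. -/
lemma inner_chartDifferential_normal_normal (hX : IsSolution Γ f T X ν) {x₀ : M}
    {z : EuclideanSpace ℝ (Fin n)} {t : ℝ} (hz : (z, t) ∈ chartDomain n x₀ T)
    (v : EuclideanSpace ℝ (Fin n)) :
    inner ℝ (chartDifferential x₀ T ν (z, t) v) (chartMap x₀ ν (z, t)) = 0 := by
  have h1 := hasFDerivAt_chartMap_slice hX.smooth_normal hz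
  have h2 := (h1.inner ℝ h1).congr_of_eventuallyEq (f₁ := fun _ => (1 : ℝ)) ?_
  · have h3 := congrArg (fun L => L v) (h2.unique (hasFDerivAt_const (1 : ℝ) z))
    simp [fderivInnerCLM_apply] at h3
    rw [real_inner_comm (chartDifferential x₀ T ν (z, t) v)] at h3
    linarith
  · filter_upwards [(isOpen_extChartAt_target x₀).mem_nhds hz.1] with y hy
    have hq : (y, t) ∈ chartDomain n x₀ T := ⟨hy, hz.2⟩
    rw [real_inner_self_eq_norm_sq, hX.norm_chartMap_normal hq, one_pow]

/-- The Weingarten map is self-adjoint. -/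
lemma inner_chartDifferential_symm (hX : IsSolution Γ f T X ν) {x₀ : M}
    {z : EuclideanSpace ℝ (Fin n)} {t : ℝ} (hz : (z, t) ∈ chartDomain n x₀ T)
    (v w : EuclideanSpace ℝ (Fin n)) :
    inner ℝ (chartDifferential x₀ T ν (z, t) v) (chartDifferential x₀ T X (z, t) w) =
      inner ℝ (chartDifferential x₀ T X (z, t) v) (chartDifferential x₀ T ν (z, t) w) := by
  set g := fun y => chartMap x₀ X (y, t) with hg
  have hgs : ContDiffAt ℝ ∞ g z := contDiffAt_chartMap_slice hX.smooth hz
  have hν := hasFDerivAt_chartMap_slice hX.smooth_normal hz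
  have hdg : DifferentiableAt ℝ (fderiv ℝ g) z :=
    (hgs.fderiv_right (m := ∞) (by simp)).differentiableAt (by simp)
  have hfd : ∀ y ∈ (extChartAt (𝓡 n) x₀).target, fderiv ℝ g y = chartDifferential x₀ T X (y, t) :=
    fun y hy => (hasFDerivAt_chartMap_slice hX.smooth ⟨hy, hz.2⟩).fderiv
  -- Differentiating `⟨dX w, ν⟩ = 0` expresses the second fundamental form through the Hessian of
  -- the immersion, which is symmetric.
  have key : ∀ v w, inner ℝ (chartDifferential x₀ T ν (z, t) v) (chartDifferential x₀ T X (z, t) w)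
      = -inner ℝ (fderiv ℝ (fderiv ℝ g) z v w) (chartMap x₀ ν (z, t)) := by
    intro v w
    have h1 := hdg.hasFDerivAt.clm_apply (hasFDerivAt_const w z)
    have h2 := (h1.inner ℝ hν).congr_of_eventuallyEq (f₁ := fun _ => (0 : ℝ)) ?_
    · have h3 := congrArg (fun L => L v) (h2.unique (hasFDerivAt_const (0 : ℝ) z))
      simp [fderivInnerCLM_apply] at h3
      rw [hfd z hz.1] at h3
      rw [real_inner_comm]
      linarith
    · filter_upwards [(isOpen_extChartAt_target x₀).mem_nhds hz.1] with y hy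
      rw [hfd y hy]
      have hq : (y, t) ∈ chartDomain n x₀ T := ⟨hy, hz.2⟩
      exact (hX.inner_chartDifferential_normal hq w).symm
  have hsymm : IsSymmSndFDerivAt ℝ g z := (contDiffAt_infty.1 hgs 2).isSymmSndFDerivAt (by simp)
  rw [key v w, real_inner_comm (chartDifferential x₀ T ν (z, t) w), key w v, hsymm v w]

lemma hasPrincipalCurvatures_principalCurvatures (hX : IsSolution Γ f T X ν) {t : ℝ}
    (ht : t ∈ Set.Ico 0 T) (x : M) :
    HasPrincipalCurvatures (differential (X t) x) (differential (ν t) x)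
      (principalCurvatures (X t) (ν t) x) := by
  have hx := mem_extChartAt_source (I := 𝓡 n) x
  have hz : (extChartAt (𝓡 n) x x, t) ∈ chartDomain n x T :=
    ⟨(extChartAt (𝓡 n) x).map_source hx, ht⟩
  have hrange : ∀ v, differential (ν t) x v ∈ LinearMap.range (differential (X t) x) := by
    intro v
    refine mem_range_of_inner_normal_eq_zero (hX.immersion t ht x) (N := ν t x) ?_
      (hX.inner_normal t ht x) ?_
    · rw [← norm_ne_zero_iff, hX.norm_normal t ht x]
      exact one_ne_zero
    · rw [differential_eq_chartDifferential hX.smooth_normal hx ht]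
      have := hX.inner_chartDifferential_normal_normal hz
        (chartJacobian x x v)
      rw [chartMap, (extChartAt (𝓡 n) x).left_inv hx] at this
      exact this
  obtain ⟨κ, hκ⟩ := exists_hasPrincipalCurvatures (n := n) (by simp) (hX.immersion t ht x) hrange
    (fun v w => by
      rw [differential_eq_chartDifferential hX.smooth_normal hx ht,
        differential_eq_chartDifferential hX.smooth_normal hx ht,
        differential_eq_chartDifferential hX.smooth hx ht,
        differential_eq_chartDifferential hX.smooth hx ht]
      exact hX.inner_chartDifferential_symm hz _ _)
  -- The sorted list of roots has length `n`, so the default value of `getD` is never taken.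
  have e : principalCurvatures (X t) (ν t) x = κ ∘ Tuple.sort κ := by
    have hs := hκ.sort_roots_charpoly (by simp) (hX.immersion t ht x)
    ext i
    unfold principalCurvatures weingartenMap
    rw [hs]
    simp
  rw [e]
  exact hκ.comp_perm _

omit [IsManifold (𝓡 n) ∞ M] in
lemma exists_perm_of_hasPrincipalCurvatures (hX : IsSolution Γ f T X ν) {t : ℝ}
    (ht : t ∈ Set.Ico 0 T) {x : M} {κ : Fin n → ℝ}
    (hκ : HasPrincipalCurvatures (differential (X t) x) (differential (ν t) x) κ) :
    ∃ σ : Equiv.Perm (Fin n), κ = principalCurvatures (X t) (ν t) x ∘ σ := by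
  have e : principalCurvatures (X t) (ν t) x = κ ∘ Tuple.sort κ := by
    have hs := hκ.sort_roots_charpoly (by simp) (hX.immersion t ht x)
    ext i
    unfold principalCurvatures weingartenMap
    rw [hs]
    simp
  refine ⟨(Tuple.sort κ)⁻¹, ?_⟩
  rw [e]
  ext i
  simp

end IsSolution

/-! ### Compactness of the curvature set and the flow equation in a chart -/

namespace IsSolution

variable {n : ℕ} {M : Type*} [TopologicalSpace M] [ChartedSpace (EuclideanSpace ℝ (Fin n)) M]
  {Γ : Set (Fin n → ℝ)} {f : (Fin n → ℝ) → ℝ} {T : ℝ}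
  {X ν : ℝ → M → EuclideanSpace ℝ (Fin (n + 1))}

/-- The triples `(x, t, κ)` where `0 ≤ t ≤ t₁` and `κ` lists the principal curvatures at `(x, t)`
in some order. -/
def curvatureSet (X ν : ℝ → M → EuclideanSpace ℝ (Fin (n + 1))) (t₁ : ℝ) :
    Set (M × ℝ × (Fin n → ℝ)) :=
  {c | c.2.1 ∈ Set.Icc 0 t₁ ∧
    HasPrincipalCurvatures (differential (X c.2.1) c.1) (differential (ν c.2.1) c.1) c.2.2}

/-- Along an ultrafilter, points and times converge by compactness of `M` and of `[0, t₁]`; the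
curvatures then converge by `HasPrincipalCurvatures.exists_tendsto`, applied in the chart at the
limit point. -/
lemma isCompact_curvatureSet [CompactSpace M] [IsManifold (𝓡 n) ∞ M] (hX : IsSolution Γ f T X ν)
    {t₁ : ℝ} (ht₁ : t₁ < T) : IsCompact (curvatureSet (n := n) X ν t₁) := by
  rw [isCompact_iff_ultrafilter_le_nhds]
  intro 𝒰 h𝒰
  have hmem : ∀ᶠ c in (𝒰 : Filter (M × ℝ × (Fin n → ℝ))), c ∈ curvatureSet X ν t₁ :=
    le_principal_iff.1 h𝒰
  obtain ⟨x₀, -, hx₀⟩ := isCompact_univ.ultrafilter_le_nhds (𝒰.map Prod.fst) (by simp)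
  obtain ⟨t₀, ht₀, htt₀⟩ := (isCompact_Icc (a := (0 : ℝ)) (b := t₁)).ultrafilter_le_nhds
    (𝒰.map fun c => c.2.1) (le_principal_iff.2 (hmem.mono fun c hc => hc.1))
  have hx : Tendsto (fun c : M × ℝ × (Fin n → ℝ) => c.1) 𝒰 (𝓝 x₀) := hx₀
  have ht : Tendsto (fun c : M × ℝ × (Fin n → ℝ) => c.2.1) 𝒰 (𝓝 t₀) := htt₀
  have ht₀T : t₀ ∈ Set.Ico 0 T := ⟨ht₀.1, ht₀.2.trans_lt ht₁⟩
  have hsrc : ∀ᶠ c in (𝒰 : Filter (M × ℝ × (Fin n → ℝ))), c.1 ∈ (extChartAt (𝓡 n) x₀).source :=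
    hx.eventually (extChartAt_source_mem_nhds x₀)
  have hIco : ∀ᶠ c in (𝒰 : Filter (M × ℝ × (Fin n → ℝ))), c.2.1 ∈ Set.Ico 0 T :=
    hmem.mono fun c hc => ⟨hc.1.1, hc.1.2.trans_lt ht₁⟩
  have hq₀ : (extChartAt (𝓡 n) x₀ x₀, t₀) ∈ chartDomain n x₀ T :=
    ⟨(extChartAt (𝓡 n) x₀).map_source (mem_extChartAt_source x₀), ht₀T⟩
  have hq : Tendsto (fun c : M × ℝ × (Fin n → ℝ) => (extChartAt (𝓡 n) x₀ c.1, c.2.1)) 𝒰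
      (𝓝[chartDomain n x₀ T] (extChartAt (𝓡 n) x₀ x₀, t₀)) := by
    refine tendsto_nhdsWithin_iff.2
      ⟨(((continuousAt_extChartAt x₀).tendsto.comp hx).prodMk_nhds ht), ?_⟩
    filter_upwards [hsrc, hIco] with c h1 h2
    exact ⟨(extChartAt (𝓡 n) x₀).map_source h1, h2⟩
  obtain ⟨κ₀, hκ₀, hκ⟩ := HasPrincipalCurvatures.exists_tendsto
    ((continuousOn_chartDifferential hX.smooth _ hq₀).tendsto.comp hq)
    ((continuousOn_chartDifferential hX.smooth_normal _ hq₀).tendsto.comp hq)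
    (hX.injective_chartDifferential hq₀) (κ := fun c : M × ℝ × (Fin n → ℝ) => c.2.2) (by
      filter_upwards [hsrc, hIco, hmem] with c h1 h2 h3
      exact (hX.hasPrincipalCurvatures_chart_iff h1 h2 _).2 h3.2)
  refine ⟨(x₀, t₀, κ₀), ⟨ht₀, (hX.hasPrincipalCurvatures_chart_iff (mem_extChartAt_source x₀) ht₀T
    _).1 hκ₀⟩, ?_⟩
  exact hx.prodMk_nhds (ht.prodMk_nhds hκ)

lemma mem_cone_of_hasPrincipalCurvatures (hf : IsSpeedFunction Γ f) (hX : IsSolution Γ f T X ν)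
    {t : ℝ} (ht : t ∈ Set.Ico 0 T) {x : M} {κ : Fin n → ℝ}
    (hκ : HasPrincipalCurvatures (differential (X t) x) (differential (ν t) x) κ) :
    κ ∈ Γ ∧ f κ = f (principalCurvatures (X t) (ν t) x) := by
  obtain ⟨σ, rfl⟩ := hX.exists_perm_of_hasPrincipalCurvatures ht hκ
  have h := hX.curvatures_mem t ht x
  exact ⟨hf.perm_mem _ h σ, hf.symmetric _ h σ⟩

variable [IsManifold (𝓡 n) ∞ M]

lemma contDiffAt_chartMap {x₀ : M} {Z : ℝ → M → EuclideanSpace ℝ (Fin (n + 1))}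
    (hZ : ContMDiffOn ((𝓡 n).prod 𝓘(ℝ, ℝ)) 𝓘(ℝ, EuclideanSpace ℝ (Fin (n + 1))) ∞
      (fun p : M × ℝ => Z p.2 p.1) (Set.univ ×ˢ Set.Ico 0 T))
    {q : EuclideanSpace ℝ (Fin n) × ℝ} (hq : chartDomain n x₀ T ∈ 𝓝 q) :
    ContDiffAt ℝ ∞ (chartMap x₀ Z) q :=
  (contDiffOn_chartMap hZ).contDiffAt hq

omit [IsManifold (𝓡 n) ∞ M] in
lemma fderiv_chartMap_space {x₀ : M} {Z : ℝ → M → EuclideanSpace ℝ (Fin (n + 1))}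
    {q : EuclideanSpace ℝ (Fin n) × ℝ} (hq : chartDomain n x₀ T ∈ 𝓝 q)
    (v : EuclideanSpace ℝ (Fin n)) :
    fderiv ℝ (chartMap x₀ Z) q (v, 0) = chartDifferential x₀ T Z q v := by
  rw [chartDifferential, fderivWithin_of_mem_nhds hq]
  rfl

lemma fderiv_chartMap_time (hX : IsSolution Γ f T X ν) {x₀ : M}
    {q : EuclideanSpace ℝ (Fin n) × ℝ} (hq : chartDomain n x₀ T ∈ 𝓝 q) :
    fderiv ℝ (chartMap x₀ X) q (0, 1) = -(f (principalCurvatures (X q.2) (ν q.2)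
      ((extChartAt (𝓡 n) x₀).symm q.1))) • chartMap x₀ ν q := by
  have hmem : q ∈ chartDomain n x₀ T := mem_of_mem_nhds hq
  have h1 : HasFDerivAt (chartMap x₀ X) (fderiv ℝ (chartMap x₀ X) q) q :=
    ((contDiffAt_chartMap hX.smooth hq).differentiableAt (by simp)).hasFDerivAt
  have h2 : HasDerivAt (fun s : ℝ => (q.1, s)) ((0 : EuclideanSpace ℝ (Fin n)), (1 : ℝ)) q.2 :=
    (hasDerivAt_const q.2 q.1).prodMk (hasDerivAt_id q.2)
  have h3 := (HasFDerivAt.comp_hasDerivAt q.2 h1 h2).hasDerivWithinAt (s := Set.Ico 0 T)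
  exact (uniqueDiffOn_Ico 0 T q.2 hmem.2).eq_deriv _ h3 
    (hX.flow q.2 hmem.2 ((extChartAt (𝓡 n) x₀).symm q.1))

end IsSolution

end CurvatureFlow

end

/-! ### The global minimum argument -/

theorem proposition2p6 {n : ℕ} {M : Type*} [TopologicalSpace M] [T2Space M] [CompactSpace M]
    [ChartedSpace (EuclideanSpace ℝ (Fin n)) M] [IsManifold (𝓡 n) ∞ M]
    (Γ : Set (Fin n → ℝ)) (f : (Fin n → ℝ) → ℝ) (hf : CurvatureFlow.IsSpeedFunction Γ f)
    (T : ℝ) (hT : 0 < T) (X ν : ℝ → M → EuclideanSpace ℝ (Fin (n + 1)))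
    (hX : CurvatureFlow.IsSolution Γ f T X ν)
    (m : ℕ) (hm : 1 ≤ m) (hmn : m < n) (β : ℝ) (hβ : 0 < β)
    (h0 : ∀ (x : M) (σ : Equiv.Perm (Fin n)),
      β * f (CurvatureFlow.principalCurvatures (X 0) (ν 0) x) ≤
        ∑ i : Fin m, CurvatureFlow.principalCurvatures (X 0) (ν 0) x (σ (i.castLE hmn.le))) :
    ∀ t ∈ Set.Ico 0 T, ∀ (x : M) (σ : Equiv.Perm (Fin n)),
      β * f (CurvatureFlow.principalCurvatures (X t) (ν t) x) ≤
        ∑ i : Fin m, CurvatureFlow.principalCurvatures (X t) (ν t) x (σ (i.castLE hmn.le)) := by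
  open CurvatureFlow IsSolution Filter Topology in
  intro t₁ ht₁ x₁ σ₁
  by_contra! hneg
  set J : Finset (Fin n) := Finset.univ.map (Fin.castLEEmb hmn.le) with hJ
  have hsumJ : ∀ κ : Fin n → ℝ, ∑ i ∈ J, κ i = ∑ i : Fin m, κ (i.castLE hmn.le) := fun κ => by
    simp [hJ]
  have hcompact := hX.isCompact_curvatureSet ht₁.2
  have hIco : ∀ c ∈ curvatureSet X ν t₁, c.2.1 ∈ Set.Ico 0 T :=
    fun c hc => ⟨hc.1.1, hc.1.2.trans_lt ht₁.2⟩
  have hmaps : Set.MapsTo (fun c : M × ℝ × (Fin n → ℝ) => c.2.2) (curvatureSet X ν t₁) Γ :=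
    fun c hc => (hX.mem_cone_of_hasPrincipalCurvatures hf (hIco c hc) hc.2).1
  have hκcont : Continuous (fun c : M × ℝ × (Fin n → ℝ) => c.2.2) := by fun_prop
  have hfcont : ContinuousOn (fun c : M × ℝ × (Fin n → ℝ) => f c.2.2) (curvatureSet X ν t₁) :=
    hf.smooth.continuousOn.comp hκcont.continuousOn hmaps
  have hdfcont : ContinuousOn (fun c : M × ℝ × (Fin n → ℝ) => fderiv ℝ f c.2.2)
      (curvatureSet X ν t₁) :=
    (hf.smooth.continuousOn_fderiv_of_isOpen hf.isOpen_cone (by simp)).comp hκcont.continuousOn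
      hmaps
  obtain ⟨K₀, hK₀⟩ := hcompact.bddAbove_image
    (f := fun c => ∑ i, fderiv ℝ f c.2.2 (Pi.single i 1) * c.2.2 i ^ 2)
    (continuousOn_finsetSum _ fun i _ =>
      (hdfcont.clm_apply continuousOn_const).mul (by fun_prop))
  -- `K` strictly exceeds every value of `∑ dᵢ κᵢ²` on the curvature set, which produces the final
  -- contradiction.
  set K := K₀ + 1 with hK
  set G : M × ℝ × (Fin n → ℝ) → ℝ :=
    fun c => Real.exp (-K * c.2.1) * (∑ i ∈ J, c.2.2 i - β * f c.2.2) with hG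
  have hGcont : ContinuousOn G (curvatureSet X ν t₁) :=
    ContinuousOn.mul (by fun_prop) (ContinuousOn.sub (by fun_prop)
      (continuousOn_const.mul hfcont))
  have hstart : (x₁, t₁, principalCurvatures (X t₁) (ν t₁) x₁ ∘ σ₁) ∈ curvatureSet X ν t₁ :=
    ⟨⟨ht₁.1, le_rfl⟩, (hX.hasPrincipalCurvatures_principalCurvatures ht₁ x₁).comp_perm σ₁⟩
  obtain ⟨⟨x₀, t₀, κ₀⟩, hc₀, hminG⟩ := hcompact.exists_isMinOn ⟨_, hstart⟩ hGcont
  have hmin : ∀ c ∈ curvatureSet X ν t₁, G (x₀, t₀, κ₀) ≤ G c := fun c hc => hminG hc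
  have ht₀ := hIco _ hc₀
  simp only at ht₀
  have hval : ∑ i ∈ J, κ₀ i - β * f κ₀ < 0 := by
    have h1 := hmin _ hstart
    have h2 : G (x₁, t₁, principalCurvatures (X t₁) (ν t₁) x₁ ∘ σ₁) < 0 := by
      refine mul_neg_of_pos_of_neg (Real.exp_pos _) ?_
      rw [hsumJ, hf.symmetric _ (hX.curvatures_mem t₁ ht₁ x₁) σ₁]
      exact sub_neg.2 hneg
    exact neg_of_mul_neg_right (h1.trans_lt h2) (Real.exp_pos _).le
  have ht₀pos : 0 < t₀ := by
    refine lt_of_le_of_ne ht₀.1 fun h => ?_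
    subst h
    obtain ⟨σ, hσ⟩ := hX.exists_perm_of_hasPrincipalCurvatures ht₀ hc₀.2
    simp only at hσ
    have := h0 x₀ σ
    rw [hσ, hsumJ, hf.symmetric _ (hX.curvatures_mem 0 ht₀ x₀) σ] at hval
    simp only [Function.comp] at hval
    linarith
  set q₀ : EuclideanSpace ℝ (Fin n) × ℝ := (extChartAt (𝓡 n) x₀ x₀, t₀) with hq₀
  have hsrc := mem_extChartAt_source (I := 𝓡 n) x₀
  -- Since `0 < t₀ ≤ t₁ < T`, the point is interior in time for the flow, even when `t₀ = t₁`.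
  have hdom₀ : chartDomain n x₀ T ∈ 𝓝 q₀ :=
    prod_mem_nhds ((isOpen_extChartAt_target x₀).mem_nhds
      ((extChartAt (𝓡 n) x₀).map_source hsrc)) (Ico_mem_nhds ht₀pos ht₀.2)
  have hdom : ∀ᶠ q in 𝓝 q₀, chartDomain n x₀ T ∈ 𝓝 q := eventually_mem_nhds_iff.2 hdom₀
  have hfun : ∀ (Z : ℝ → M → EuclideanSpace ℝ (Fin (n + 1))) (q : EuclideanSpace ℝ (Fin n) × ℝ),
      chartDomain n x₀ T ∈ 𝓝 q →
      (fun v => fderiv ℝ (chartMap x₀ Z) q (v, 0)) = chartDifferential x₀ T Z q :=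
    fun Z q hq => funext fun v => fderiv_chartMap_space hq v
  have hiff : ∀ q, chartDomain n x₀ T ∈ 𝓝 q → ∀ κ : Fin n → ℝ,
      HasPrincipalCurvatures (fun v => fderiv ℝ (chartMap x₀ X) q (v, 0))
        (fun v => fderiv ℝ (chartMap x₀ ν) q (v, 0)) κ ↔
      HasPrincipalCurvatures (differential (X q.2) ((extChartAt (𝓡 n) x₀).symm q.1))
        (differential (ν q.2) ((extChartAt (𝓡 n) x₀).symm q.1)) κ := by
    intro q hq κ
    have hqm : q ∈ chartDomain n x₀ T := mem_of_mem_nhds hq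
    rw [hfun X q hq, hfun ν q hq, ← hX.hasPrincipalCurvatures_chart_iff
      ((extChartAt (𝓡 n) x₀).map_target hqm.1) hqm.2, (extChartAt (𝓡 n) x₀).right_inv hqm.1]
  have hreaction := chart_reaction_le hf (contDiffAt_chartMap hX.smooth hdom₀)
    (contDiffAt_chartMap hX.smooth_normal hdom₀) (fun v hv => ?_) ?_ (κ₀ := κ₀) ?_ J β K ?_
  -- With `Z < 0`, the bound gives `K₀ Z ≤ (∑ dᵢ κᵢ²) Z ≤ (K₀ + 1) Z`, hence `0 ≤ Z`.
  · have h1 := hK₀ ⟨_, hc₀, rfl⟩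
    simp only at h1
    have h2 := mul_le_mul_of_nonpos_right h1 hval.le
    linarith
  · rw [fderiv_chartMap_space hdom₀] at hv
    exact hX.injective_chartDifferential (mem_of_mem_nhds hdom₀) (hv.trans (map_zero _).symm)
  · filter_upwards [hdom] with q hq
    have hqm : q ∈ chartDomain n x₀ T := mem_of_mem_nhds hq
    refine ⟨hX.norm_chartMap_normal hqm, fun v => ?_, ⟨_, (hiff q hq _).2
      (hX.hasPrincipalCurvatures_principalCurvatures hqm.2 _)⟩, fun κ hκ => ?_⟩
    · rw [fderiv_chartMap_space hq]
      exact hX.inner_chartDifferential_normal hqm v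
    · obtain ⟨h1, h2⟩ := hX.mem_cone_of_hasPrincipalCurvatures hf hqm.2 ((hiff q hq κ).1 hκ)
      refine ⟨h1, ?_⟩
      rw [hX.fderiv_chartMap_time hq, real_inner_smul_left, real_inner_self_eq_norm_sq,
        hX.norm_chartMap_normal hqm, h2]
      simp
  · rw [hiff q₀ hdom₀]
    simp only [hq₀, (extChartAt (𝓡 n) x₀).left_inv hsrc]
    exact hc₀.2
  · filter_upwards [hdom] with q hq hle κ hκ
    have hqm : q ∈ chartDomain n x₀ T := mem_of_mem_nhds hq
    have h1 := hmin ((extChartAt (𝓡 n) x₀).symm q.1, q.2, κ)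
      ⟨⟨hqm.2.1, hle.trans hc₀.1.2⟩, (hiff q hq κ).1 hκ⟩
    -- Multiplication by `exp (K q.2)` turns minimality of `G` into the weighted inequality with
    -- factor `exp (K (q.2 - t₀))`.
    have h2 := mul_le_mul_of_nonneg_left h1 (Real.exp_pos (K * q.2)).le
    simp only [hG, ← mul_assoc, ← Real.exp_add] at h2
    have e1 : K * q.2 + -K * t₀ = K * (q.2 - t₀) := by ring
    have e2 : K * q.2 + -K * q.2 = 0 := by ring
    rw [e1, e2, Real.exp_zero, one_mul] at h2
    exact h2
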